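/- Let $(S,\Sigma,\mu)$ be a probability space and let $P(x,A)$ be a transition probability on $S\times\Sigma$ for which $\mu$ is invariant, i.e. $\int P(x,A)\,d\mu(x)=\mu(A)$ for all $A\in\Sigma$. Let $Pf(x)=\int f(y)\,P(x,dy)$ be the corresponding (bi-stochastic) Markov operator, which is a contraction of every complex space $L^p(\mu)$, $1\le p\le\infty$. Let $P^*$ be the dual operator, also a contraction of every $L^p(\mu)$, where $P^*f$ is the Radon–Nikodym derivative with respect to $\mu$ of $A\mapsto\int f(x)P(x,A)\,d\mu(x)$; equivalently, $\int (P^*f)\,g\,d\mu=\int f\,(Pg)\,d\mu$ for $f\in L^p(\mu)$, $g\in L^\infty(\mu)$. Assume that $P$ is ergodic ($Pf=f\in L^\infty(\mu)$ implies that $f$ is constant a.e.) and that $P$ is quasi-compact on $L^2(\mu)$ (there are $n\ge1$ and a compact operator $K$ on $L^2(\mu)$ with $\|P^n-K\|<1$). Let $d$ be the period of $P$, i.e. the smallest integer $d\ge 1$ such that every point $\lambda$ with $|\lambda|=1$ of the spectrum of $P$ on $L^2(\mu)$ satisfies $\lambda^d=1$, and assume $d>1$. Put $\Sigma_{i,d}=\{A\in\Sigma:\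 P^d1_A=1_A \text{ a.e.}\}$. Then: (i) $\Sigma_{i,d}$ is a $\sigma$-algebra which is finite modulo $\mu$-null sets. It has pairwise disjoint atoms $A_0,A_1,\dots,A_{d-1}$ (sets of $\Sigma_{i,d}$ of positive measure, such that each subset of $A_j$ belonging to $\Sigma_{i,d}$ is null or differs from $A_j$ by a null set) which, together with the $\mu$-null sets of $\Sigma$, generate $\Sigma_{i,d}$. With indices taken modulo $d$, $P^j1_{A_0}=1_{A_j}$, $P1_{A_j}=1_{A_{j+1}}$ and $P^*1_{A_{j+1}}=1_{A_j}$ a.e. for all $j$. (ii) With the same sets $A_j$, for every $1\le p<\infty$, every $f\in L^p(\mu)$ and every $0\le j\le d-1$, $$\lim_{n\to\infty}\Big\|P^{nd+j}f-d\sum_{\ell=0}^{d-1}\Big(\int_{A_\ell}f\,d\mu\Big)1_{A_{\ell+j}}\Big\|_p=0,\qquad \lim_{n\to\infty}\Big\|(P^*)^{nd+j}f-d\sum_{\ell=0}^{d-1}\Big(\int_{A_\ell}f\,d\mu\Big)1_{A_{\ell-j}}\Big\|_p=0 ,$$ where the indices $\ell\pm j$ are taken modulo $d$. (iii) For every $1\le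 p<\infty$, the eigenvalues of $P$ on $L^p(\mu)$ of modulus one are precisely all $d$-th roots of unity, and every corresponding eigenfunction has a.e. constant absolute value. -/

import Mathlib

open MeasureTheory ProbabilityTheory Filter Topology
open scoped ENNReal

noncomputable section

namespace MarkovCycle

section Aux

variable {S Ω : Type*} [MeasurableSpace S] [MeasurableSpace Ω]

/-- If `g ∘ X` is a version of the conditional expectation of `F` given `X`, then the `L^p` norm of
`g` is at most that of `F`. -/
lemma eLpNorm_le_of_setIntegral {μ : Measure S} {ρ : Measure Ω} [IsProbabilityMeasure ρ]
    {X : Ω → S} (hX : MeasurePreserving X ρ μ) {g : S → ℂ} {F : Ω → ℂ}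
    (hg : Integrable g μ) (hF : Integrable F ρ)
    (h : ∀ A, MeasurableSet A → ∫ x in A, g x ∂μ = ∫ z in X ⁻¹' A, F z ∂ρ)
    {p : ℝ≥0∞} (hp : 1 ≤ p) : eLpNorm g p μ ≤ eLpNorm F p ρ := by
  have hm : MeasurableSpace.comap X inferInstance ≤ (inferInstance : MeasurableSpace Ω) :=
    hX.measurable.comap_le
  have hgX : Integrable (g ∘ X) ρ := hX.integrable_comp_of_integrable hg
  have key : g ∘ X =ᵐ[ρ] ρ[F | MeasurableSpace.comap X inferInstance] := by
    refine ae_eq_condExp_of_forall_setIntegral_eq hm hF (fun s _ _ => hgX.integrableOn) ?_ ?_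
    · rintro s ⟨A, hA, rfl⟩ _
      rw [← h A hA, ← hX.map_eq, setIntegral_map hA (by rw [hX.map_eq]; exact hg.1)
        hX.measurable.aemeasurable]
      rfl
    · refine ⟨hg.1.mk g ∘ X, hg.1.stronglyMeasurable_mk.comp_measurable
        (comap_measurable X), ?_⟩
      exact hX.quasiMeasurePreserving.ae_eq_comp hg.1.ae_eq_mk
  rw [← eLpNorm_comp_measurePreserving hg.1 hX, eLpNorm_congr_ae key]
  exact eLpNorm_condExp_le_eLpNorm F hp

end Aux

variable {S : Type*} [MeasurableSpace S]

/-- `(Pf)(x) = ∫ f(y) P(x, dy)` for the transition probability `κ`. -/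
def markovFun (κ : Kernel S S) (f : S → ℂ) (x : S) : ℂ := ∫ y, f y ∂(κ x)

/-- The complex measure `A ↦ ∫ f(x) P(x, A) μ(dx)`. -/
def pushMeasure (κ : Kernel S S) (μ : Measure S) (f : S → ℂ) : ComplexMeasure S :=
  ((μ ⊗ₘ κ).withDensityᵥ (fun z : S × S => f z.1)).map Prod.snd

/-- `P* f` is the Radon–Nikodym derivative with respect to `μ` of `A ↦ ∫ f(x) P(x, A) μ(dx)`. -/
def dualFun (κ : Kernel S S) (μ : Measure S) (f : S → ℂ) : S → ℂ :=
  (pushMeasure κ μ f).rnDeriv μ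

lemma markovFun_congr {κ : Kernel S S} {μ : Measure S} (h : Kernel.Invariant κ μ) {f g : S → ℂ} (hfg : f =ᵐ[μ] g) :
    markovFun κ f =ᵐ[μ] markovFun κ g := by
  have hfg' : ∀ᵐ x ∂(μ.bind κ), f x = g x := by
    rw [h.def]
    exact hfg
  filter_upwards [Measure.ae_ae_of_ae_comp hfg'] with x hx using integral_congr_ae hx

lemma markovFun_add {κ : Kernel S S} {μ : Measure S} (h : Kernel.Invariant κ μ) {f g : S → ℂ} (hf : Integrable f μ)
    (hg : Integrable g μ) : markovFun κ (f + g) =ᵐ[μ] markovFun κ f + markovFun κ g := by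
  have aux : ∀ {f : S → ℂ}, Integrable f μ → ∀ᵐ x ∂μ, Integrable f (κ x) := fun {f} hf => by
    have hf' : Integrable f (μ.bind κ) := by
      rw [h.def]
      exact hf
    exact ((Measure.integrable_comp_iff hf'.1).1 hf').1
  filter_upwards [aux hf, aux hg] with x h1 h2 using integral_add h1 h2

section Facts

variable {κ : Kernel S S} [IsMarkovKernel κ] {μ : Measure S} [IsProbabilityMeasure μ]

lemma measurePreserving_fst :
    MeasurePreserving (Prod.fst : S × S → S) (μ ⊗ₘ κ) μ :=
  ⟨measurable_fst, Measure.fst_compProd μ κ⟩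

lemma measurePreserving_snd (h : Kernel.Invariant κ μ) :
    MeasurePreserving (Prod.snd : S × S → S) (μ ⊗ₘ κ) μ :=
  ⟨measurable_snd, (Measure.snd_compProd μ κ).trans h⟩

lemma markovFun_spec (h : Kernel.Invariant κ μ) {f : S → ℂ} (hf : Integrable f μ) :
    Integrable (markovFun κ f) μ ∧ ∀ A, MeasurableSet A →
      ∫ x in A, markovFun κ f x ∂μ = ∫ z in Prod.fst ⁻¹' A, f z.2 ∂(μ ⊗ₘ κ) := by
  have hF : Integrable (fun z : S × S => f z.2) (μ ⊗ₘ κ) :=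
    (measurePreserving_snd h).integrable_comp_of_integrable hf
  have hf' : Integrable f (μ.bind κ) := by
    rw [h.def]
    exact hf
  have hm : AEStronglyMeasurable (markovFun κ f) μ :=
    ⟨fun x => ∫ y, hf'.1.mk f y ∂(κ x), hf'.1.stronglyMeasurable_mk.integral_kernel, by
      filter_upwards [Measure.ae_ae_of_ae_comp hf'.1.ae_eq_mk] with x hx
        using integral_congr_ae hx⟩
  refine ⟨((Measure.integrable_comp_iff hf'.1).1 hf').2.mono' hm
    (.of_forall fun x => norm_integral_le_integral_norm _), fun A hA => ?_⟩
  rw [← Set.prod_univ, Measure.setIntegral_compProd hA MeasurableSet.univ hF.integrableOn]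
  simp [markovFun]

lemma dualFun_spec (h : Kernel.Invariant κ μ) {f : S → ℂ} (hf : Integrable f μ) :
    Integrable (dualFun κ μ f) μ ∧ ∀ A, MeasurableSet A →
      ∫ x in A, dualFun κ μ f x ∂μ = ∫ z in Prod.snd ⁻¹' A, f z.1 ∂(μ ⊗ₘ κ) := by
  have hF : Integrable (fun z : S × S => f z.1) (μ ⊗ₘ κ) :=
    measurePreserving_fst.integrable_comp_of_integrable hf
  have hpush : ∀ A, MeasurableSet A →
      pushMeasure κ μ f A = ∫ z in Prod.snd ⁻¹' A, f z.1 ∂(μ ⊗ₘ κ) := fun A hA => by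
    rw [pushMeasure, VectorMeasure.map_apply _ measurable_snd hA,
      withDensityᵥ_apply hF (measurable_snd hA)]
  have hac : pushMeasure κ μ f ≪ᵥ μ.toENNRealVectorMeasure := by
    refine VectorMeasure.AbsolutelyContinuous.mk fun A hA hA0 => ?_
    rw [Measure.toENNRealVectorMeasure_apply_measurable hA] at hA0
    rw [hpush A hA]
    apply setIntegral_measure_zero
    rw [(measurePreserving_snd h).measure_preimage hA.nullMeasurableSet, hA0]
  rw [ComplexMeasure.absolutelyContinuous_ennreal_iff] at hac
  have hint : Integrable (dualFun κ μ f) μ := ComplexMeasure.integrable_rnDeriv _ _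
  refine ⟨hint, fun A hA => ?_⟩
  rw [← hpush A hA]
  have hre := congrArg (fun v : SignedMeasure S => v A)
    (SignedMeasure.withDensityᵥ_rnDeriv_eq _ μ hac.1)
  have him := congrArg (fun v : SignedMeasure S => v A)
    (SignedMeasure.withDensityᵥ_rnDeriv_eq _ μ hac.2)
  simp only [withDensityᵥ_apply (SignedMeasure.integrable_rnDeriv _ _) hA] at hre him
  have hre' : ∫ x in A, (dualFun κ μ f x).re ∂μ = (pushMeasure κ μ f A).re := hre
  have him' : ∫ x in A, (dualFun κ μ f x).im ∂μ = (pushMeasure κ μ f A).im := him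
  apply Complex.ext
  · have := setIntegral_re_add_im (𝕜 := ℂ) (f := dualFun κ μ f) (i := A) hint.integrableOn
    rw [← this]
    simpa using hre'
  · have := setIntegral_re_add_im (𝕜 := ℂ) (f := dualFun κ μ f) (i := A) hint.integrableOn
    rw [← this]
    simpa using him'

variable {p : ℝ≥0∞} [hp : Fact (1 ≤ p)]

lemma eLpNorm_markovFun_le (h : Kernel.Invariant κ μ) {f : S → ℂ} (hf : MemLp f p μ) :
    eLpNorm (markovFun κ f) p μ ≤ eLpNorm f p μ := by
  have hi := hf.integrable hp.out
  have hF : Integrable (fun z : S × S => f z.2) (μ ⊗ₘ κ) :=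
    (measurePreserving_snd h).integrable_comp_of_integrable hi
  have hs := markovFun_spec h hi
  refine (eLpNorm_le_of_setIntegral measurePreserving_fst hs.1 hF hs.2 hp.out).trans_eq ?_
  exact eLpNorm_comp_measurePreserving hi.1 (measurePreserving_snd h)

lemma memLp_markovFun (h : Kernel.Invariant κ μ) {f : S → ℂ} (hf : MemLp f p μ) :
    MemLp (markovFun κ f) p μ :=
  ⟨(markovFun_spec h (hf.integrable hp.out)).1.1, (eLpNorm_markovFun_le h hf).trans_lt hf.2⟩

lemma eLpNorm_dualFun_le (h : Kernel.Invariant κ μ) {f : S → ℂ} (hf : MemLp f p μ) :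
    eLpNorm (dualFun κ μ f) p μ ≤ eLpNorm f p μ := by
  have hi := hf.integrable hp.out
  have hF : Integrable (fun z : S × S => f z.1) (μ ⊗ₘ κ) :=
    measurePreserving_fst.integrable_comp_of_integrable hi
  have hs := dualFun_spec h hi
  refine (eLpNorm_le_of_setIntegral (measurePreserving_snd h) hs.1 hF hs.2 hp.out).trans_eq ?_
  exact eLpNorm_comp_measurePreserving hi.1 measurePreserving_fst

lemma memLp_dualFun (h : Kernel.Invariant κ μ) {f : S → ℂ} (hf : MemLp f p μ) :
    MemLp (dualFun κ μ f) p μ :=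
  ⟨(dualFun_spec h (hf.integrable hp.out)).1.1, (eLpNorm_dualFun_le h hf).trans_lt hf.2⟩

lemma dualFun_ae_eq (h : Kernel.Invariant κ μ) {f g : S → ℂ} (hf : Integrable f μ)
    (hg : Integrable g μ)
    (hfg : ∀ A, MeasurableSet A →
      ∫ x in A, g x ∂μ = ∫ z in Prod.snd ⁻¹' A, f z.1 ∂(μ ⊗ₘ κ)) :
    dualFun κ μ f =ᵐ[μ] g :=
  (dualFun_spec h hf).1.ae_eq_of_forall_setIntegral_eq _ _ hg
    fun A hA _ => ((dualFun_spec h hf).2 A hA).trans (hfg A hA).symm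

lemma dualFun_congr {f g : S → ℂ} (hfg : f =ᵐ[μ] g) : dualFun κ μ f = dualFun κ μ g := by
  have : (fun z : S × S => f z.1) =ᵐ[μ ⊗ₘ κ] fun z => g z.1 :=
    measurePreserving_fst.quasiMeasurePreserving.ae_eq_comp hfg
  rw [dualFun, dualFun, pushMeasure, pushMeasure, WithDensityᵥEq.congr_ae this]

lemma dualFun_add (h : Kernel.Invariant κ μ) {f g : S → ℂ} (hf : Integrable f μ)
    (hg : Integrable g μ) : dualFun κ μ (f + g) =ᵐ[μ] dualFun κ μ f + dualFun κ μ g := by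
  refine dualFun_ae_eq h (hf.add hg) ((dualFun_spec h hf).1.add (dualFun_spec h hg).1) ?_
  intro A hA
  have hf' : Integrable (fun z : S × S => f z.1) (μ ⊗ₘ κ) :=
    measurePreserving_fst.integrable_comp_of_integrable hf
  have hg' : Integrable (fun z : S × S => g z.1) (μ ⊗ₘ κ) :=
    measurePreserving_fst.integrable_comp_of_integrable hg
  simp only [Pi.add_apply]
  rw [integral_add (dualFun_spec h hf).1.integrableOn (dualFun_spec h hg).1.integrableOn,
    integral_add hf'.integrableOn hg'.integrableOn, (dualFun_spec h hf).2 A hA,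
    (dualFun_spec h hg).2 A hA]

lemma dualFun_smul (h : Kernel.Invariant κ μ) (c : ℂ) {f : S → ℂ} (hf : Integrable f μ) :
    dualFun κ μ (c • f) =ᵐ[μ] c • dualFun κ μ f := by
  refine dualFun_ae_eq h (hf.smul c) ((dualFun_spec h hf).1.smul c) ?_
  intro A hA
  simp only [Pi.smul_apply]
  rw [integral_smul, integral_smul, (dualFun_spec h hf).2 A hA]

end Facts

/-- The Markov operator `P` on complex `L^p(μ)` of a transition probability `κ` with invariant
probability `μ`; it is a contraction. -/
def markovOp (κ : Kernel S S) [IsMarkovKernel κ] (μ : Measure S) [IsProbabilityMeasure μ]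
    (h : Kernel.Invariant κ μ) (p : ℝ≥0∞) [hp : Fact (1 ≤ p)] : Lp ℂ p μ →L[ℂ] Lp ℂ p μ :=
  LinearMap.mkContinuous
    { toFun := fun f => (memLp_markovFun h (Lp.memLp f)).toLp (markovFun κ f)
      map_add' := fun f g => by
        rw [← MemLp.toLp_add, MemLp.toLp_eq_toLp_iff]
        exact (markovFun_congr h (Lp.coeFn_add f g)).trans (markovFun_add h
          ((Lp.memLp f).integrable hp.out) ((Lp.memLp g).integrable hp.out))
      map_smul' := fun c f => by
        rw [RingHom.id_apply, ← MemLp.toLp_const_smul, MemLp.toLp_eq_toLp_iff]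
        refine (markovFun_congr h (Lp.coeFn_smul c f)).trans (.of_forall fun x => ?_)
        exact integral_smul c _ }
    1 fun f => by
      rw [one_mul]
      refine (Lp.norm_toLp (markovFun κ f) (memLp_markovFun h (Lp.memLp f))).trans_le ?_
      exact ENNReal.toReal_mono (Lp.memLp f).2.ne (eLpNorm_markovFun_le h (Lp.memLp f))

/-- The dual Markov operator `P*` on complex `L^p(μ)`: `∫ (P* f) g dμ = ∫ f (P g) dμ` for
bounded `g`. -/
def dualOp (κ : Kernel S S) [IsMarkovKernel κ] (μ : Measure S) [IsProbabilityMeasure μ]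
    (h : Kernel.Invariant κ μ) (p : ℝ≥0∞) [hp : Fact (1 ≤ p)] : Lp ℂ p μ →L[ℂ] Lp ℂ p μ :=
  LinearMap.mkContinuous
    { toFun := fun f => (memLp_dualFun h (Lp.memLp f)).toLp (dualFun κ μ f)
      map_add' := fun f g => by
        rw [← MemLp.toLp_add, MemLp.toLp_eq_toLp_iff, dualFun_congr (Lp.coeFn_add f g)]
        exact dualFun_add h ((Lp.memLp f).integrable hp.out) ((Lp.memLp g).integrable hp.out)
      map_smul' := fun c f => by
        rw [RingHom.id_apply, ← MemLp.toLp_const_smul, MemLp.toLp_eq_toLp_iff,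
          dualFun_congr (Lp.coeFn_smul c f)]
        exact dualFun_smul h c ((Lp.memLp f).integrable hp.out) }
    1 fun f => by
      rw [one_mul]
      refine (Lp.norm_toLp (dualFun κ μ f) (memLp_dualFun h (Lp.memLp f))).trans_le ?_
      exact ENNReal.toReal_mono (Lp.memLp f).2.ne (eLpNorm_dualFun_le h (Lp.memLp f))

/-- `P` is ergodic: every `P`-invariant function in `L^∞(μ)` is constant a.e. -/
def IsErgodic (κ : Kernel S S) [IsMarkovKernel κ] (μ : Measure S) [IsProbabilityMeasure μ]
    (h : Kernel.Invariant κ μ) : Prop :=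
  ∀ f : Lp ℂ ∞ μ, markovOp κ μ h ∞ f = f → ∃ c : ℂ, ∀ᵐ x ∂μ, f x = c

/-- `T` is quasi-compact: `‖T ^ n - K‖ < 1` for some `n ≥ 1` and some compact operator `K`. -/
def IsQuasiCompact {X : Type*} [NormedAddCommGroup X] [NormedSpace ℂ X] (T : X →L[ℂ] X) : Prop :=
  ∃ n : ℕ, 1 ≤ n ∧ ∃ K : X →L[ℂ] X, IsCompactOperator K ∧ ‖T ^ n - K‖ < 1

/-- `d` is the period of `T`: the smallest `d ≥ 1` such that every point of the spectrum of `T` on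
the unit circle is a `d`-th root of unity. -/
def IsPeriod {X : Type*} [NormedAddCommGroup X] [NormedSpace ℂ X] (T : X →L[ℂ] X) (d : ℕ) : Prop :=
  IsLeast {k : ℕ | 1 ≤ k ∧ ∀ z ∈ spectrum ℂ T, ‖z‖ = 1 → z ^ k = 1} d

/-- The indicator function of `A` as an element of `L^p(μ)`. -/
def ind (μ : Measure S) [IsProbabilityMeasure μ] (p : ℝ≥0∞) (A : Set S)
    (hA : MeasurableSet A) : Lp ℂ p μ :=
  indicatorConstLp p hA (measure_ne_top μ A) (1 : ℂ)

/-- The family of `P^k`-invariant sets: measurable `A` with `P^k 1_A = 1_A` a.e. -/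
def invariantSets (κ : Kernel S S) [IsMarkovKernel κ] (μ : Measure S) [IsProbabilityMeasure μ]
    (h : Kernel.Invariant κ μ) (k : ℕ) : Set (Set S) :=
  {A | ∃ hA : MeasurableSet A, (markovOp κ μ h ∞ ^ k) (ind μ ∞ A hA) = ind μ ∞ A hA}

/-- The family `𝓕` of sets is finite modulo `μ`-null sets. -/
def FiniteMod (μ : Measure S) (𝓕 : Set (Set S)) : Prop :=
  ∃ 𝓖 : Set (Set S), 𝓖.Finite ∧ ∀ B ∈ 𝓕, ∃ C ∈ 𝓖, B =ᵐ[μ] C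

/-- `A` is an atom of the family `𝓕` for `μ`. -/
def IsAtomOf (μ : Measure S) (𝓕 : Set (Set S)) (A : Set S) : Prop :=
  A ∈ 𝓕 ∧ 0 < μ A ∧ ∀ B ∈ 𝓕, B ⊆ A → μ B = 0 ∨ μ (A \ B) = 0

/-- `𝓕` is the σ-algebra generated, modulo `μ`-null sets, by the family `𝓐`: it is the σ-algebra
generated by `𝓐` together with the measurable `μ`-null sets. -/
def IsGeneratedMod (μ : Measure S) (𝓕 𝓐 : Set (Set S)) : Prop :=
  𝓕 = {B | MeasurableSet[MeasurableSpace.generateFrom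
    (𝓐 ∪ {N | MeasurableSet N ∧ μ N = 0})] B}

end MarkovCycle

end

set_option linter.unusedSectionVars false

/-! Quasi-compactness turns the unimodular spectrum into eigenvalues, and ergodicity makes the
eigenfunctions rigid. If `Pf = zf` with `|z| = 1`, then `|f| ≤ P|f|`; since `μ` is invariant this is
an equality, so `|f|` is constant. After scaling, `z f(x)` is a number of modulus one that averages
points of the unit circle under `P(x, ·)`, and strict convexity gives the cocycle relation `f(y) = z
f(x)` along almost every transition (`IsUnimodularEigenfunction.of_markovFun`). Cocycles can be
multiplied and inverted, so the unimodular eigenvalues form a group, and the definition of the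
period makes it the group of all `d`-th roots of unity.

The cocycle of a primitive root has an invariant, hence constant, `d`-th power. Its discrete
logarithm is a map `φ` to `ℤ/d` that drops by one along almost every transition
(`IsErgodic.exists_isCyclicIndex`). The level sets of `φ` are the atoms, and the action of `P` and
`P*` on their indicators can be read off from `φ`.

For the limits, `L²` splits into the span of these indicators, which `P` rotates, and its orthogonal
complement, preserved by `P` and `P*`. Each eigenfunction is a multiple of some `z⁻¹ ^ φ`, so the
complement contains none, and the powers decay there in operator norm
(`IsCyclicIndex.tendsto_pow_sub_cyclicLimit_two`). Boundedness on `L^∞` and density carry the limits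
to every `L^p` with `p < ∞` (`tendsto_Lp_of_tendsto_two`). Applied to the indicator of a
`P^d`-invariant set, the limit shows that the set is a function of `φ` modulo null sets. -/

namespace MarkovCycle

/-! ### Peripheral spectrum of quasi-compact contractions -/

section QuasiCompact

variable {X : Type*} [NormedAddCommGroup X] [NormedSpace ℂ X] [CompleteSpace X]

/-- A point of the spectrum of modulus at least the norm is an approximate eigenvalue. -/
lemma not_antilipschitz_of_mem_spectrum {T : X →L[ℂ] X} {z : ℂ} (hz : z ∈ spectrum ℂ T)
    (hTz : ‖T‖ ≤ ‖z‖) (hz0 : z ≠ 0) {c : ℝ} (hc : 0 < c) : ∃ v : X, ‖T v - z • v‖ < c * ‖v‖ := by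
  by_contra! hcon
  apply hz
  -- Push `z` radially outwards to `w = (1 + t) z`: this leaves the disc of radius `‖T‖`, so `w` is
  -- in the resolvent set, yet `w` stays within `c / 2` of `z`.
  obtain ⟨t, ht0, ht⟩ : ∃ t : ℝ, 0 < t ∧ t * ‖z‖ < c / 2 :=
    ⟨c / 4 / ‖z‖, by positivity, by rw [div_mul_cancel₀ _ (norm_ne_zero_iff.2 hz0)]; linarith⟩
  set w : ℂ := z + t * z with hw
  have hwz : ‖w - z‖ < c / 2 := by
    rw [hw, add_sub_cancel_left, norm_mul, Complex.norm_real, Real.norm_of_nonneg ht0.le]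
    exact ht
  have hwT : IsUnit (algebraMap ℂ (X →L[ℂ] X) w - T) := by
    by_cases hX : Nontrivial X
    · refine spectrum.mem_resolventSet_of_norm_lt (hTz.trans_lt ?_)
      have : w = ((1 + t : ℝ) : ℂ) * z := by push_cast; ring
      rw [this, norm_mul, Complex.norm_real, Real.norm_of_nonneg (by positivity)]
      have := norm_pos_iff.2 hz0
      nlinarith
    · rw [not_nontrivial_iff_subsingleton] at hX
      exact isUnit_of_subsingleton _
  -- The assumed lower bound `c` for `T - z` leaves the lower bound `c / 2` for `w - T`, so its
  -- inverse has norm at most `2 / c` and a Neumann series reaches back from `w` to `z`.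
  obtain ⟨u, hu⟩ := hwT
  have hub : ∀ v, c / 2 * ‖v‖ ≤ ‖(u : X →L[ℂ] X) v‖ := fun v => by
    have h1 : (u : X →L[ℂ] X) v = (w - z) • v - (T v - z • v) := by
      rw [hu, sub_apply, ContinuousLinearMap.algebraMap_apply]
      module
    have h2 : ‖T v - z • v‖ - ‖(w - z) • v‖ ≤ ‖(u : X →L[ℂ] X) v‖ := by
      rw [h1, ← norm_neg ((w - z) • v - _), neg_sub]
      exact norm_sub_norm_le _ _
    rw [norm_smul] at h2
    nlinarith [hcon v, norm_nonneg v]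
  have huinv : ‖(↑u⁻¹ : X →L[ℂ] X)‖ ≤ 2 / c := by
    refine ContinuousLinearMap.opNorm_le_bound _ (by positivity) fun v => ?_
    have h1 := hub ((↑u⁻¹ : X →L[ℂ] X) v)
    have h2 : (u : X →L[ℂ] X) ((↑u⁻¹ : X →L[ℂ] X) v) = v := by
      rw [← mul_apply_eq_comp, u.mul_inv, one_apply_eq_self]
    rw [h2] at h1
    rw [div_mul_eq_mul_div, le_div_iff₀ hc]
    linarith
  have hsmall : ‖(w - z) • (↑u⁻¹ : X →L[ℂ] X)‖ < 1 := by
    rw [norm_smul]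
    calc ‖w - z‖ * ‖(↑u⁻¹ : X →L[ℂ] X)‖ ≤ ‖w - z‖ * (2 / c) := by gcongr
      _ < c / 2 * (2 / c) := by gcongr
      _ = 1 := by field_simp
  have hfac : algebraMap ℂ (X →L[ℂ] X) z - T
      = u * (1 - (w - z) • (↑u⁻¹ : X →L[ℂ] X)) := by
    rw [mul_sub, mul_one, mul_smul_comm, u.mul_inv, hu, ← Algebra.algebraMap_eq_smul_one,
      map_sub]
    abel
  rw [spectrum.mem_resolventSet_iff, hfac]
  exact u.isUnit.mul (isUnit_one_sub_of_norm_lt_one hsmall)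

/-- The points of the spectrum of modulus one of a quasi-compact contraction are eigenvalues. -/
lemma IsQuasiCompact.exists_eigenvector {T : X →L[ℂ] X} (hT : IsQuasiCompact T) (hT1 : ‖T‖ ≤ 1)
    {z : ℂ} (hz : z ∈ spectrum ℂ T) (hz1 : ‖z‖ = 1) : ∃ v : X, v ≠ 0 ∧ T v = z • v := by
  obtain ⟨n, -, K, hK, hnK⟩ := hT
  have hz0 : z ≠ 0 := by
    rintro rfl
    simp at hz1
  have hex : ∀ k : ℕ, ∃ v : X, ‖v‖ = 1 ∧ ‖T v - z • v‖ < 1 / ((k : ℝ) + 1) := fun k => by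
    obtain ⟨v, hv⟩ := not_antilipschitz_of_mem_spectrum hz (hT1.trans_eq hz1.symm) hz0
      (c := 1 / ((k : ℝ) + 1)) (by positivity)
    have hv0 : v ≠ 0 := by
      rintro rfl
      simp at hv
    have hvn : 0 < ‖v‖ := norm_pos_iff.2 hv0
    refine ⟨((‖v‖⁻¹ : ℝ) : ℂ) • v, ?_, ?_⟩
    · rw [norm_smul, Complex.norm_real, norm_inv, norm_norm, inv_mul_cancel₀ hvn.ne']
    · rw [map_smul, smul_comm, ← smul_sub, norm_smul, Complex.norm_real, norm_inv, norm_norm,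
        inv_mul_lt_iff₀ hvn, mul_comm ‖v‖]
      exact hv
  choose v hv1 hvT using hex
  have hlim : Tendsto (fun k => T (v k) - z • v k) atTop (𝓝 0) :=
    squeeze_zero_norm (fun k => (hvT k).le) tendsto_one_div_add_atTop_nhds_zero_nat
  set w := algebraMap ℂ (X →L[ℂ] X) z with hw
  obtain ⟨Q, hQ⟩ : ∃ Q : X →L[ℂ] X, T ^ n - w ^ n = Q * (T - w) :=
    ⟨_, (Commute.geom_sum₂_mul (Algebra.commutes z T).symm n).symm⟩
  have hlimn : Tendsto (fun k => (T ^ n - w ^ n) (v k)) atTop (𝓝 0) := by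
    have := (Q.continuous.tendsto 0).comp hlim
    rw [map_zero] at this
    refine this.congr fun k => ?_
    rw [hQ, mul_apply_eq_comp, sub_apply, hw, ContinuousLinearMap.algebraMap_apply,
      Function.comp_apply]
  -- Here `‖T ^ n - K‖ < 1 = |z ^ n|`. This invertible operator sends `v k` to `K (v k)` minus a
  -- null sequence.
  have hunit : IsUnit (w ^ n - (T ^ n - K)) := by
    rw [hw, ← map_pow]
    by_cases hX : Nontrivial X
    · refine spectrum.mem_resolventSet_of_norm_lt ?_
      simpa [hz1] using hnK
    · rw [not_nontrivial_iff_subsingleton] at hX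
      exact isUnit_of_subsingleton _
  obtain ⟨u, hu⟩ := hunit
  obtain ⟨y, -, φ, hφ, hy⟩ := (hK.isCompact_closure_image_closedBall 1).isSeqCompact
    (x := fun k => K (v k)) fun k => subset_closure ⟨v k, by simp [hv1 k], rfl⟩
  -- Compactness gives convergence of `K (v k)` only; inverting `u` upgrades it to convergence of
  -- the approximate eigenvectors themselves.
  have hconv : Tendsto (fun k => v (φ k)) atTop (𝓝 ((↑u⁻¹ : X →L[ℂ] X) y)) := by
    have h1 := hy.sub (hlimn.comp hφ.tendsto_atTop)
    rw [sub_zero] at h1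
    refine (((↑u⁻¹ : X →L[ℂ] X).continuous.tendsto y).comp h1).congr fun k => ?_
    have h2 : K (v (φ k)) - (T ^ n - w ^ n) (v (φ k)) = (u : X →L[ℂ] X) (v (φ k)) := by
      rw [hu]
      simp only [sub_apply]
      abel
    simp only [Function.comp_apply, h2]
    rw [← mul_apply_eq_comp, u.inv_mul, one_apply_eq_self]
  set v₀ := (↑u⁻¹ : X →L[ℂ] X) y
  refine ⟨v₀, ?_, ?_⟩
  · have : ‖v₀‖ = 1 := tendsto_nhds_unique hconv.norm (by simp [hv1])
    rw [← norm_ne_zero_iff, this]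
    exact one_ne_zero
  · have h1 : Tendsto (fun k => T (v (φ k)) - z • v (φ k)) atTop (𝓝 (T v₀ - z • v₀)) :=
      ((T.continuous.tendsto v₀).comp hconv).sub (hconv.const_smul z)
    exact sub_eq_zero.1 (tendsto_nhds_unique h1 (hlim.comp hφ.tendsto_atTop))

/-- The powers of an operator whose spectral radius is less than one tend to zero. -/
lemma tendsto_norm_pow_of_spectralRadius_lt_one {R : X →L[ℂ] X} (h : spectralRadius ℂ R < 1) :
    Tendsto (fun n : ℕ => ‖R ^ n‖) atTop (𝓝 0) := by
  obtain ⟨r, hr1, hr2⟩ := ENNReal.lt_iff_exists_nnreal_btwn.1 h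
  have hr2' : (r : ℝ) < 1 := by exact_mod_cast hr2
  refine squeeze_zero' (.of_forall fun n => norm_nonneg _) ?_
    (tendsto_pow_atTop_nhds_zero_of_lt_one r.2 hr2')
  filter_upwards [(spectrum.pow_nnnorm_pow_one_div_tendsto_nhds_spectralRadius R).eventually_lt_const
    hr1, eventually_gt_atTop 0] with n hn hn0
  have h1 := ENNReal.rpow_le_rpow hn.le (Nat.cast_nonneg (α := ℝ) n)
  rw [← ENNReal.rpow_mul, one_div, inv_mul_cancel₀ (by positivity), ENNReal.rpow_one,
    ENNReal.rpow_natCast] at h1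
  exact_mod_cast h1

end QuasiCompact

/-! ### Decay of powers on an invariant subspace of a Hilbert space -/

section Hilbert

variable {H : Type*} [NormedAddCommGroup H] [InnerProductSpace ℂ H]
  {T : H →L[ℂ] H} {E : Submodule ℂ H} [E.HasOrthogonalProjection]

/-- The inner projections act on vectors already in `E` and drop out. At `n = 0` the left side is
the identity, hence the restriction on `n`. -/
lemma mul_starProjection_pow (hE : ∀ v ∈ E, T v ∈ E) {n : ℕ} (hn : 1 ≤ n) :
    (T * E.starProjection) ^ n = T ^ n * E.starProjection := by
  induction n, hn using Nat.le_induction with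
  | base => simp
  | succ n _ ih =>
    rw [pow_succ', ih, pow_succ']
    ext v
    have hmem : (T ^ n) (E.starProjection v) ∈ E := by
      clear ih
      induction n with
      | zero => simp
      | succ n ih =>
        rcases Nat.eq_zero_or_pos n with rfl | h
        · simpa using hE _ (E.starProjection_apply_mem v)
        · rw [pow_succ']
          exact hE _ (ih h)
    simp only [mul_apply_eq_comp, E.starProjection_eq_self_iff.2 hmem]

/-- If a quasi-compact contraction has no eigenvector with unimodular eigenvalue in an invariant
closed subspace, then its powers tend to zero there. -/
lemma IsQuasiCompact.tendsto_norm_pow_mul_starProjection [CompleteSpace H]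
    (hT : IsQuasiCompact T) (hT1 : ‖T‖ ≤ 1)
    (hE : ∀ v ∈ E, T v ∈ E)
    (hev : ∀ z : ℂ, ‖z‖ = 1 → ∀ v ∈ E, T v = z • v → v = 0) :
    Tendsto (fun n : ℕ => ‖T ^ n * E.starProjection‖) atTop (𝓝 0) := by
  -- `R` stands in for the restriction of `T` to `E`, so that everything takes place on the whole
  -- space.
  set R : H →L[ℂ] H := T * E.starProjection with hR
  have hQ1 : ‖E.starProjection‖ ≤ 1 := E.starProjection_norm_le
  have hR1 : ‖R‖ ≤ 1 := (norm_mul_le _ _).trans (mul_le_one₀ hT1 (norm_nonneg _) hQ1)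
  have hRqc : IsQuasiCompact R := by
    obtain ⟨n, hn, K, hK, hnK⟩ := hT
    refine ⟨n, hn, K * E.starProjection, hK.comp_clm E.starProjection, ?_⟩
    rw [hR, mul_starProjection_pow hE hn, ← sub_mul]
    exact ((norm_mul_le _ _).trans (mul_le_of_le_one_right (norm_nonneg _) hQ1)).trans_lt hnK
  have hrad : spectralRadius ℂ R < 1 := by
    by_cases hX : Nontrivial H
    -- The spectral radius is attained. Were it one, `R` would have an eigenvector `v = z⁻¹ R v`,
    -- which lies in `E` and contradicts `hev`.
    · obtain ⟨z, hz, hzr⟩ := spectrum.exists_nnnorm_eq_spectralRadius R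
      refine lt_of_le_of_ne ((spectrum.spectralRadius_le_nnnorm R).trans
        (by exact_mod_cast hR1)) fun h1 => ?_
      have hz1 : ‖z‖ = 1 := by
        rw [h1, ENNReal.coe_eq_one] at hzr
        exact congrArg NNReal.toReal hzr
      obtain ⟨v, hv0, hv⟩ := hRqc.exists_eigenvector hR1 hz hz1
      have hz0 : z ≠ 0 := by
        rintro rfl
        simp at hz1
      have hvE : v ∈ E := by
        rw [← inv_smul_smul₀ hz0 v, ← hv]
        exact E.smul_mem _ (hE _ (E.starProjection_apply_mem v))
      refine hv0 (hev z hz1 v hvE ?_)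
      rw [← hv, hR, mul_apply_eq_comp, E.starProjection_eq_self_iff.2 hvE]
    · rw [not_nontrivial_iff_subsingleton] at hX
      rw [spectrum.SpectralRadius.of_subsingleton]
      exact one_pos
  refine (tendsto_norm_pow_of_spectralRadius_lt_one hrad).congr' ?_
  filter_upwards [eventually_ge_atTop 1] with n hn
  rw [hR, mul_starProjection_pow hE hn]

lemma tendsto_norm_pow_apply_of_mem
    (h : Tendsto (fun n : ℕ => ‖T ^ n * E.starProjection‖) atTop (𝓝 0)) {v : H} (hv : v ∈ E) :
    Tendsto (fun n : ℕ => ‖(T ^ n) v‖) atTop (𝓝 0) := by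
  refine squeeze_zero (fun n => norm_nonneg _) (fun n => ?_) (by simpa using h.mul_const ‖v‖)
  have := (T ^ n * E.starProjection).le_opNorm v
  rwa [mul_apply_eq_comp, E.starProjection_eq_self_iff.2 hv] at this

/-- With `y` the image of `v` under the `n`-th power of the adjoint, `‖y‖² = ⟨v, T ^ n y⟩`. The
decay in operator norm is essential: strong convergence need not pass to adjoints. -/
lemma tendsto_norm_adjoint_pow_apply_of_mem [CompleteSpace H]
    (hE : ∀ v ∈ E, ContinuousLinearMap.adjoint T v ∈ E)
    (h : Tendsto (fun n : ℕ => ‖T ^ n * E.starProjection‖) atTop (𝓝 0)) {v : H} (hv : v ∈ E) :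
    Tendsto (fun n : ℕ => ‖(ContinuousLinearMap.adjoint T ^ n) v‖) atTop (𝓝 0) := by
  refine squeeze_zero (fun n => norm_nonneg _) (fun n => ?_) (by simpa using h.mul_const ‖v‖)
  have hmem : (ContinuousLinearMap.adjoint T ^ n) v ∈ E := by
    induction n with
    | zero => simpa
    | succ n ih =>
      rw [pow_succ']
      exact hE _ ih
  set y := (ContinuousLinearMap.adjoint T ^ n) v with hy
  have hadj : ContinuousLinearMap.adjoint (T ^ n) = ContinuousLinearMap.adjoint T ^ n := by
    rw [← ContinuousLinearMap.star_eq_adjoint, star_pow, ContinuousLinearMap.star_eq_adjoint]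
  have h1 : ‖y‖ * ‖y‖ ≤ ‖T ^ n * E.starProjection‖ * ‖v‖ * ‖y‖ := by
    calc ‖y‖ * ‖y‖ = ‖inner ℂ y y‖ := by simp [inner_self_eq_norm_sq_to_K, sq]
      _ = ‖inner ℂ v ((T ^ n * E.starProjection) y)‖ := by
          conv_lhs => rw [hy, ← hadj, ContinuousLinearMap.adjoint_inner_left, hadj, ← hy]
          rw [mul_apply_eq_comp, E.starProjection_eq_self_iff.2 hmem]
      _ ≤ ‖v‖ * (‖T ^ n * E.starProjection‖ * ‖y‖) :=
          (norm_inner_le_norm _ _).trans (by gcongr; exact ContinuousLinearMap.le_opNorm _ _)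
      _ = _ := by ring
  rcases (norm_nonneg y).eq_or_lt with h0 | h0
  · rw [← h0]
    positivity
  · exact le_of_mul_le_mul_right h1 h0

end Hilbert

/-! ### Rigidity of unimodular eigenfunctions -/

section Cocycle

variable {S : Type*} [MeasurableSpace S] {κ : Kernel S S} [IsMarkovKernel κ] {μ : Measure S}
  [IsProbabilityMeasure μ]

lemma coeFn_markovOp (h : Kernel.Invariant κ μ) {p : ℝ≥0∞} [hp : Fact (1 ≤ p)] (f : Lp ℂ p μ) :
    markovOp κ μ h p f =ᵐ[μ] markovFun κ f :=
  MemLp.coeFn_toLp (memLp_markovFun h (Lp.memLp f))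

lemma coeFn_dualOp (h : Kernel.Invariant κ μ) {p : ℝ≥0∞} [hp : Fact (1 ≤ p)] (f : Lp ℂ p μ) :
    dualOp κ μ h p f =ᵐ[μ] dualFun κ μ f :=
  MemLp.coeFn_toLp (memLp_dualFun h (Lp.memLp f))

lemma norm_markovOp_le (h : Kernel.Invariant κ μ) (p : ℝ≥0∞) [hp : Fact (1 ≤ p)] :
    ‖markovOp κ μ h p‖ ≤ 1 :=
  LinearMap.mkContinuous_norm_le _ zero_le_one _

lemma norm_dualOp_le (h : Kernel.Invariant κ μ) (p : ℝ≥0∞) [hp : Fact (1 ≤ p)] :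
    ‖dualOp κ μ h p‖ ≤ 1 :=
  LinearMap.mkContinuous_norm_le _ zero_le_one _

lemma ae_fst {q : S → Prop} (hq : ∀ᵐ x ∂μ, q x) : ∀ᵐ w ∂(μ ⊗ₘ κ), q w.1 :=
  measurePreserving_fst.quasiMeasurePreserving.ae hq

lemma ae_snd (h : Kernel.Invariant κ μ) {q : S → Prop} (hq : ∀ᵐ x ∂μ, q x) :
    ∀ᵐ w ∂(μ ⊗ₘ κ), q w.2 :=
  (measurePreserving_snd h).quasiMeasurePreserving.ae hq

lemma ae_kernel (h : Kernel.Invariant κ μ) {q : S → Prop} (hq : ∀ᵐ x ∂μ, q x) :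
    ∀ᵐ x ∂μ, ∀ᵐ y ∂(κ x), q y :=
  Measure.ae_ae_of_ae_compProd (ae_snd h hq)

/-- If `F y = G x` for almost every transition from `x` to `y`, then `P F = G`. -/
lemma markovFun_ae_eq_of_cocycle {F G : S → ℂ} (hFG : ∀ᵐ w ∂(μ ⊗ₘ κ), F w.2 = G w.1) :
    markovFun κ F =ᵐ[μ] G := by
  filter_upwards [Measure.ae_ae_of_ae_compProd hFG] with x hx
  rw [markovFun, integral_congr_ae hx, integral_const]
  simp

/-- If `F y = G x` for almost every transition from `x` to `y`, then `P* G = F`. -/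
lemma dualFun_ae_eq_of_cocycle (h : Kernel.Invariant κ μ) {F G : S → ℂ} (hF : Integrable F μ)
    (hG : Integrable G μ) (hFG : ∀ᵐ w ∂(μ ⊗ₘ κ), F w.2 = G w.1) : dualFun κ μ G =ᵐ[μ] F := by
  refine dualFun_ae_eq h hG hF fun A hA => ?_
  rw [← setIntegral_congr_ae (measurable_snd hA) (hFG.mono fun w hw _ => hw)]
  have h2 := measurePreserving_snd (κ := κ) h
  conv_lhs => rw [← h2.map_eq]
  rw [setIntegral_map hA (by rw [h2.map_eq]; exact hF.1) measurable_snd.aemeasurable]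

lemma integrable_kernel (h : Kernel.Invariant κ μ) {g : S → ℝ} (hg : Integrable g μ) :
    (∀ᵐ x ∂μ, Integrable g (κ x)) ∧ Integrable (fun x => ∫ y, g y ∂(κ x)) μ ∧
      ∫ x, ∫ y, g y ∂(κ x) ∂μ = ∫ x, g x ∂μ := by
  have hsnd := measurePreserving_snd (κ := κ) h
  have hG : Integrable (fun w : S × S => g w.2) (μ ⊗ₘ κ) :=
    hsnd.integrable_comp_of_integrable hg
  refine ⟨((Measure.integrable_compProd_iff hG.1).1 hG).1, ?_, ?_⟩
  · refine (markovFun_spec h (hg.ofReal (𝕜 := ℂ))).1.re.congr (.of_forall fun x => ?_)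
    exact (congrArg Complex.re (integral_ofReal (𝕜 := ℂ))).trans (Complex.ofReal_re _)
  rw [← Measure.integral_compProd hG]
  conv_rhs => rw [← hsnd.map_eq]
  rw [integral_map measurable_snd.aemeasurable (by rw [hsnd.map_eq]; exact hg.1)]

/-- By invariance `g` and `Pg` have the same integral, so the nonnegative function `Pg - g` has
integral zero. -/
lemma integral_kernel_eq_of_le (h : Kernel.Invariant κ μ) {g : S → ℝ} (hg : Integrable g μ)
    (hle : ∀ᵐ x ∂μ, g x ≤ ∫ y, g y ∂(κ x)) : ∀ᵐ x ∂μ, ∫ y, g y ∂(κ x) = g x := by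
  obtain ⟨-, h2, h3⟩ := integrable_kernel h hg
  have hz : ∫ x, (∫ y, g y ∂(κ x)) - g x ∂μ = 0 := by
    rw [integral_sub h2 hg, h3, sub_self]
  rw [integral_eq_zero_iff_of_nonneg_ae (hle.mono fun x hx => sub_nonneg.2 hx) (h2.sub hg)] at hz
  exact hz.mono fun x hx => sub_eq_zero.1 hx

lemma integral_kernel_eq_of_ge (h : Kernel.Invariant κ μ) {g : S → ℝ} (hg : Integrable g μ)
    (hle : ∀ᵐ x ∂μ, ∫ y, g y ∂(κ x) ≤ g x) : ∀ᵐ x ∂μ, ∫ y, g y ∂(κ x) = g x := by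
  have := integral_kernel_eq_of_le h hg.neg (hle.mono fun x hx => by
    simpa only [Pi.neg_apply, integral_neg, neg_le_neg_iff] using hx)
  exact this.mono fun x hx => by simpa only [Pi.neg_apply, integral_neg, neg_inj] using hx

/-- Ergodicity in terms of functions. -/
lemma IsErgodic.ae_const {h : Kernel.Invariant κ μ} (herg : IsErgodic κ μ h) {F : S → ℂ}
    (hF : MemLp F ∞ μ) (hinv : markovFun κ F =ᵐ[μ] F) : ∃ c : ℂ, ∀ᵐ x ∂μ, F x = c := by
  obtain ⟨c, hc⟩ := herg (hF.toLp F) (by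
    refine Lp.ext ((coeFn_markovOp h _).trans ?_)
    exact ((markovFun_congr h hF.coeFn_toLp).trans hinv).trans hF.coeFn_toLp.symm)
  exact ⟨c, by filter_upwards [hc, hF.coeFn_toLp] with x h1 h2; rw [← h2, h1]⟩

/-- An integrable function `g ≥ 0` invariant under an ergodic Markov operator is constant. -/
lemma IsErgodic.ae_const_of_nonneg {h : Kernel.Invariant κ μ} (herg : IsErgodic κ μ h)
    {g : S → ℝ} (hg : Integrable g μ) (hg0 : ∀ x, 0 ≤ g x)
    (hinv : ∀ᵐ x ∂μ, ∫ y, g y ∂(κ x) = g x) : ∃ c : ℝ, ∀ᵐ x ∂μ, g x = c := by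
  -- Ergodicity speaks of bounded functions only. The truncations satisfy `P (min g N) ≤ min g N`,
  -- hence are invariant too.
  have htrunc : ∀ N : ℕ, ∃ c : ℂ, ∀ᵐ x ∂μ, ((min (g x) N : ℝ) : ℂ) = c := fun N => by
    have hmin : Integrable (fun x => min (g x) (N : ℝ)) μ := hg.inf (integrable_const _)
    have hle : ∀ᵐ x ∂μ, ∫ y, min (g y) (N : ℝ) ∂(κ x) ≤ min (g x) N := by
      filter_upwards [hinv, (integrable_kernel h hg).1, (integrable_kernel h hmin).1]
        with x hx hi hi'
      refine le_min (hx ▸ integral_mono hi' hi fun y => min_le_left _ _) ?_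
      refine (integral_mono hi' (integrable_const (N : ℝ)) fun y => min_le_right _ _).trans_eq ?_
      simp
    have heq := integral_kernel_eq_of_ge h hmin hle
    refine herg.ae_const (F := fun x => ((min (g x) N : ℝ) : ℂ)) ?_ ?_
    · refine memLp_top_of_bound hmin.ofReal.1 (N : ℝ) (.of_forall fun x => ?_)
      rw [Complex.norm_real, Real.norm_of_nonneg (le_min (hg0 x) (Nat.cast_nonneg N))]
      exact min_le_right _ _
    · filter_upwards [heq] with x hx
      rw [← hx, markovFun]
      exact integral_ofReal
  choose c hc using htrunc
  -- At `x₀` all truncations take their constant values. For a level `N` above `g x₀` the constant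
  -- lies below `N`, so the truncation is inactive almost everywhere.
  obtain ⟨x₀, hx₀⟩ := (ae_all_iff.2 hc).exists
  obtain ⟨N, hN⟩ := exists_nat_gt (g x₀)
  refine ⟨g x₀, ?_⟩
  filter_upwards [hc N] with x hx
  have h1 : min (g x) (N : ℝ) = min (g x₀) N := by exact_mod_cast hx.trans (hx₀ N).symm
  rw [min_eq_left hN.le] at h1
  rcases min_choice (g x) (N : ℝ) with h2 | h2
  · rw [← h1, h2]
  · rw [h2] at h1
    exact absurd h1 hN.ne'

/-- Integrable eigenfunctions with unimodular eigenvalue of an ergodic Markov operator have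
constant modulus. -/
lemma IsErgodic.norm_ae_const {h : Kernel.Invariant κ μ} (herg : IsErgodic κ μ h) {f : S → ℂ}
    (hf : Integrable f μ) {z : ℂ} (hz : ‖z‖ = 1) (hfz : ∀ᵐ x ∂μ, markovFun κ f x = z * f x) :
    ∃ c : ℝ, ∀ᵐ x ∂μ, ‖f x‖ = c := by
  refine herg.ae_const_of_nonneg hf.norm (fun x => norm_nonneg _)
    (integral_kernel_eq_of_le h hf.norm ?_)
  filter_upwards [hfz] with x hx
  calc ‖f x‖ = ‖markovFun κ f x‖ := by rw [hx, norm_mul, hz, one_mul]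
    _ ≤ _ := norm_integral_le_integral_norm _

variable (κ μ) in
/-- `f` is a function of modulus one which is multiplied by `z` along almost every transition. -/
structure IsUnimodularEigenfunction (z : ℂ) (f : S → ℂ) : Prop where
  measurable : Measurable f
  norm_eq_one : ∀ᵐ x ∂μ, ‖f x‖ = 1
  cocycle : ∀ᵐ w ∂(μ ⊗ₘ κ), f w.2 = z * f w.1

namespace IsUnimodularEigenfunction

variable {z z' : ℂ} {f f' : S → ℂ}

/-- Strict convexity of the disc: the average `z * f x` of `f` under `κ x` lies on the unit circle,
so `f` equals it `κ x`-almost everywhere. -/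
lemma of_markovFun (h : Kernel.Invariant κ μ) (hf : Measurable f) (hf1 : ∀ᵐ x ∂μ, ‖f x‖ = 1)
    (hz : ‖z‖ = 1) (hfz : ∀ᵐ x ∂μ, markovFun κ f x = z * f x) :
    IsUnimodularEigenfunction κ μ z f := by
  refine ⟨hf, hf1, Measure.ae_compProd_of_ae_ae (p := fun w => f w.2 = z * f w.1)
    (measurableSet_eq_fun (by fun_prop) (by fun_prop)) ?_⟩
  filter_upwards [hfz, hf1, ae_kernel h hf1] with x h1 h2 h3
  have h4 : ⨍ y, f y ∂(κ x) = z * f x := by rw [average_eq_integral]; exact h1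
  rcases ae_eq_const_or_norm_average_lt_of_norm_le_const (h3.mono fun y hy => hy.le) with h5 | h5
  · rw [h4] at h5
    exact h5
  · rw [h4, norm_mul, hz, h2, mul_one] at h5
    exact absurd h5 (lt_irrefl _)

lemma const {c : ℂ} (hc : ‖c‖ = 1) : IsUnimodularEigenfunction κ μ 1 fun _ => c :=
  ⟨measurable_const, .of_forall fun _ => hc, .of_forall fun _ => (one_mul c).symm⟩

lemma mul (hf : IsUnimodularEigenfunction κ μ z f) (hf' : IsUnimodularEigenfunction κ μ z' f') :
    IsUnimodularEigenfunction κ μ (z * z') (f * f') := by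
  refine ⟨hf.measurable.mul hf'.measurable, ?_, ?_⟩
  · filter_upwards [hf.norm_eq_one, hf'.norm_eq_one] with x h1 h2
    simp [h1, h2]
  · filter_upwards [hf.cocycle, hf'.cocycle] with w h1 h2
    simp only [Pi.mul_apply, h1, h2]
    ring

lemma inv (hf : IsUnimodularEigenfunction κ μ z f) :
    IsUnimodularEigenfunction κ μ z⁻¹ f⁻¹ := by
  refine ⟨hf.measurable.inv, ?_, ?_⟩
  · filter_upwards [hf.norm_eq_one] with x h1
    simp [h1]
  · filter_upwards [hf.cocycle] with w h1
    simp [h1, mul_comm]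

lemma pow (hf : IsUnimodularEigenfunction κ μ z f) (n : ℕ) :
    IsUnimodularEigenfunction κ μ (z ^ n) (f ^ n) := by
  induction n with
  | zero => simpa only [pow_zero] using! const (κ := κ) (μ := μ) norm_one
  | succ n ih => simpa only [pow_succ] using ih.mul hf

lemma norm_eigenvalue (h : Kernel.Invariant κ μ) (hf : IsUnimodularEigenfunction κ μ z f) :
    ‖z‖ = 1 := by
  obtain ⟨w, h1, h2, h3⟩ :=
    (hf.cocycle.and ((ae_fst hf.norm_eq_one).and (ae_snd h hf.norm_eq_one))).exists
  rwa [h1, norm_mul, h2, mul_one] at h3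

lemma memLp (hf : IsUnimodularEigenfunction κ μ z f) (p : ℝ≥0∞) : MemLp f p μ :=
  .of_bound hf.measurable.aestronglyMeasurable 1 (hf.norm_eq_one.mono fun _ hx => hx.le)

lemma markovFun_ae_eq (hf : IsUnimodularEigenfunction κ μ z f) :
    markovFun κ f =ᵐ[μ] fun x => z * f x :=
  markovFun_ae_eq_of_cocycle hf.cocycle

lemma markovOp_toLp (h : Kernel.Invariant κ μ) (hf : IsUnimodularEigenfunction κ μ z f)
    (p : ℝ≥0∞) [hp : Fact (1 ≤ p)] :
    markovOp κ μ h p ((hf.memLp p).toLp f) = z • (hf.memLp p).toLp f := by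
  refine Lp.ext ?_
  filter_upwards [coeFn_markovOp h ((hf.memLp p).toLp f),
    markovFun_congr h (hf.memLp p).coeFn_toLp, hf.markovFun_ae_eq,
    Lp.coeFn_smul z ((hf.memLp p).toLp f), (hf.memLp p).coeFn_toLp] with x h1 h2 h3 h4 h5
  rw [h1, h2, h3, h4, Pi.smul_apply, h5, smul_eq_mul]

lemma toLp_ne_zero (hf : IsUnimodularEigenfunction κ μ z f) (p : ℝ≥0∞) :
    (hf.memLp p).toLp f ≠ 0 := fun h0 => by
  have h1 := (hf.memLp p).coeFn_toLp
  rw [h0] at h1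
  obtain ⟨x, h2, h3, h4⟩ := (h1.and ((Lp.coeFn_zero ℂ p μ).and hf.norm_eq_one)).exists
  rw [← h2, h3] at h4
  simp at h4

/-- Eigenfunctions of an ergodic operator with the same eigenvalue are proportional. -/
lemma ae_eq_const_mul {h : Kernel.Invariant κ μ} (herg : IsErgodic κ μ h)
    (hf : IsUnimodularEigenfunction κ μ z f) (hf' : IsUnimodularEigenfunction κ μ z f') :
    ∃ c : ℂ, ∀ᵐ x ∂μ, f x = c * f' x := by
  have hz0 : z ≠ 0 := norm_ne_zero_iff.1 (by rw [hf.norm_eigenvalue h]; exact one_ne_zero)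
  -- The quotient is a cocycle with eigenvalue one, that is, an invariant bounded function.
  have hq := hf.mul hf'.inv
  rw [mul_inv_cancel₀ hz0] at hq
  obtain ⟨c, hc⟩ := herg.ae_const (hq.memLp ∞) (by simpa only [one_mul] using! hq.markovFun_ae_eq)
  refine ⟨c, ?_⟩
  filter_upwards [hc, hf'.norm_eq_one] with x h1 h2
  have h3 : f' x ≠ 0 := norm_ne_zero_iff.1 (by rw [h2]; exact one_ne_zero)
  rw [← h1, Pi.mul_apply, Pi.inv_apply, inv_mul_cancel_right₀ h3]

end IsUnimodularEigenfunction

/-- An eigenvector in `L^p` with unimodular eigenvalue is a multiple of a unimodular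
eigenfunction. -/
lemma IsErgodic.exists_isUnimodularEigenfunction {h : Kernel.Invariant κ μ}
    (herg : IsErgodic κ μ h) {p : ℝ≥0∞} [hp : Fact (1 ≤ p)] {z : ℂ} (hz : ‖z‖ = 1)
    {v : Lp ℂ p μ} (hv0 : v ≠ 0) (hv : markovOp κ μ h p v = z • v) :
    ∃ (c : ℂ) (f : S → ℂ), IsUnimodularEigenfunction κ μ z f ∧ ∀ᵐ x ∂μ, v x = c * f x := by
  have hvi : Integrable v μ := (Lp.memLp v).integrable hp.out
  have hvz : ∀ᵐ x ∂μ, markovFun κ v x = z * v x := by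
    filter_upwards [coeFn_markovOp h v, Lp.coeFn_smul z v] with x h1 h2
    rw [← h1, hv, h2, Pi.smul_apply, smul_eq_mul]
  obtain ⟨c, hc⟩ := herg.norm_ae_const hvi hz hvz
  have hc0 : c ≠ 0 := by
    rintro rfl
    refine hv0 (Lp.ext ?_)
    filter_upwards [hc, Lp.coeFn_zero ℂ p μ] with x h1 h2
    rw [h2, norm_eq_zero.1 h1, Pi.zero_apply]
  have hcpos : 0 ≤ c := by
    obtain ⟨x, hx⟩ := hc.exists
    exact hx ▸ norm_nonneg _
  have hm := (Lp.stronglyMeasurable v).measurable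
  refine ⟨c, fun x => (c : ℂ)⁻¹ * v x, .of_markovFun h (hm.const_mul _) ?_ hz ?_, ?_⟩
  · filter_upwards [hc] with x hx
    rw [norm_mul, hx, norm_inv, Complex.norm_real, Real.norm_of_nonneg hcpos,
      inv_mul_cancel₀ hc0]
  · filter_upwards [hvz] with x hx
    rw [mul_left_comm, ← hx]
    exact integral_const_mul _ _
  · exact .of_forall fun x => by
      rw [mul_inv_cancel_left₀ (Complex.ofReal_ne_zero.2 hc0)]

end Cocycle

/-! ### The cyclic index with values in `ℤ/d` -/

section Index

variable {S : Type*} [MeasurableSpace S] {κ : Kernel S S} [IsMarkovKernel κ] {μ : Measure S}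
  [IsProbabilityMeasure μ]

lemma coeFn_ind {p : ℝ≥0∞} {A : Set S} (hA : MeasurableSet A) :
    ind μ p A hA =ᵐ[μ] A.indicator fun _ => (1 : ℂ) :=
  indicatorConstLp_coeFn

lemma ind_ae_eq_iff {p : ℝ≥0∞} {A B : Set S} (hA : MeasurableSet A) (hB : MeasurableSet B) :
    ind μ p A hA = ind μ p B hB ↔ A =ᵐ[μ] B := by
  refine ⟨fun h => ?_, fun h => Lp.ext ?_⟩
  · have h1 := (coeFn_ind (p := p) hA).symm.trans (h ▸ coeFn_ind (p := p) hB)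
    filter_upwards [h1] with x hx
    by_cases hxA : x ∈ A <;> by_cases hxB : x ∈ B <;> simp_all [Set.indicator]
    · exact iff_of_true hxA hxB
    · exact iff_of_false hxA hxB
  · exact ((coeFn_ind hA).trans (indicator_ae_eq_of_ae_eq_set h)).trans (coeFn_ind hB).symm

lemma ind_congr {p : ℝ≥0∞} {A B : Set S} (hA : MeasurableSet A) (hB : MeasurableSet B)
    (h : A = B) : ind μ p A hA = ind μ p B hB := by
  subst h
  rfl

lemma integrable_indicator_one {A : Set S} (hA : MeasurableSet A) :
    Integrable (A.indicator fun _ => (1 : ℂ)) μ :=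
  (integrable_const _).indicator hA

lemma markovOp_ind (h : Kernel.Invariant κ μ) (p : ℝ≥0∞) [hp : Fact (1 ≤ p)] {A B : Set S}
    (hA : MeasurableSet A) (hB : MeasurableSet B)
    (hAB : ∀ᵐ w ∂(μ ⊗ₘ κ), w.2 ∈ A ↔ w.1 ∈ B) :
    markovOp κ μ h p (ind μ p A hA) = ind μ p B hB := by
  refine Lp.ext ?_
  refine (coeFn_markovOp h _).trans (((markovFun_congr h (coeFn_ind hA)).trans ?_).trans
    (coeFn_ind hB).symm)
  exact markovFun_ae_eq_of_cocycle (hAB.mono fun w hw => by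
    by_cases hw' : w.1 ∈ B <;> simp [Set.indicator, hw, hw'])

lemma dualOp_ind (h : Kernel.Invariant κ μ) (p : ℝ≥0∞) [hp : Fact (1 ≤ p)] {A B : Set S}
    (hA : MeasurableSet A) (hB : MeasurableSet B)
    (hAB : ∀ᵐ w ∂(μ ⊗ₘ κ), w.2 ∈ A ↔ w.1 ∈ B) :
    dualOp κ μ h p (ind μ p B hB) = ind μ p A hA := by
  refine Lp.ext ?_
  refine (coeFn_dualOp h _).trans ?_
  rw [dualFun_congr (coeFn_ind hB)]
  refine (dualFun_ae_eq_of_cocycle h (integrable_indicator_one hA) (integrable_indicator_one hB)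
    ?_).trans (coeFn_ind hA).symm
  exact hAB.mono fun w hw => by
    by_cases hw' : w.1 ∈ B <;> simp [Set.indicator, hw, hw']

variable (κ μ) in
/-- `φ` is a measurable index in `ℤ/d` which decreases by one along almost every transition. -/
structure IsCyclicIndex {d : ℕ} (φ : S → ZMod d) : Prop where
  measurable : Measurable φ
  step : ∀ᵐ w ∂(μ ⊗ₘ κ), φ w.1 = φ w.2 + 1

/-- Unimodular eigenvalues of an operator of period `d` are `d`-th roots of unity. -/
lemma IsUnimodularEigenfunction.pow_eq_one {h : Kernel.Invariant κ μ} {d : ℕ}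
    (hper : IsPeriod (markovOp κ μ h 2) d) {z : ℂ} {f : S → ℂ}
    (hf : IsUnimodularEigenfunction κ μ z f) : z ^ d = 1 := by
  have hev : Module.End.HasEigenvalue (markovOp κ μ h 2 : Lp ℂ 2 μ →ₗ[ℂ] Lp ℂ 2 μ) z :=
    Module.End.hasEigenvalue_of_hasEigenvector
      ⟨Module.End.mem_eigenspace_iff.2 (hf.markovOp_toLp h 2), hf.toLp_ne_zero 2⟩
  refine hper.1.2 z ?_ (hf.norm_eigenvalue h)
  rw [ContinuousLinearMap.spectrum_eq]
  exact hev.mem_spectrum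

/-- The unimodular eigenvalues of an ergodic quasi-compact Markov operator of period `d` contain a
primitive `d`-th root of unity. -/
lemma IsErgodic.exists_isPrimitiveRoot {h : Kernel.Invariant κ μ} (herg : IsErgodic κ μ h)
    (hqc : IsQuasiCompact (markovOp κ μ h 2)) {d : ℕ} (hper : IsPeriod (markovOp κ μ h 2) d) :
    ∃ (ζ : ℂ) (f : S → ℂ), IsPrimitiveRoot ζ d ∧ IsUnimodularEigenfunction κ μ ζ f := by
  obtain ⟨⟨hd, -⟩, hmin⟩ := id hper
  -- The group of unimodular eigenvalues sits inside the `d`-th roots of unity, so it is finite and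
  -- cyclic.
  let Γ : Subgroup ℂˣ :=
    { carrier := {u | ∃ f, IsUnimodularEigenfunction κ μ (u : ℂ) f}
      mul_mem' := fun ⟨f, hf⟩ ⟨g, hg⟩ => ⟨f * g, hf.mul hg⟩
      one_mem' := ⟨_, .const norm_one⟩
      inv_mem' := fun ⟨f, hf⟩ => ⟨f⁻¹, by simpa using hf.inv⟩ }
  have hΓ : Γ ≤ rootsOfUnity d ℂ := fun u ⟨f, hf⟩ => by
    rw [mem_rootsOfUnity]
    refine Units.ext ?_
    simpa using hf.pow_eq_one hper
  have : NeZero d := ⟨by omega⟩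
  have hfin : Finite Γ := Finite.of_injective _ (Subgroup.inclusion_injective hΓ)
  obtain ⟨g, hg⟩ := IsCyclic.exists_generator (α := Γ)
  obtain ⟨f, hf⟩ := g.2
  have hgd : ((g : ℂˣ) : ℂ) ^ d = 1 := by
    have := hΓ g.2
    rw [mem_rootsOfUnity] at this
    simpa using congrArg Units.val this
  have hg' : IsPrimitiveRoot (((g : ℂˣ) : ℂ)) (orderOf g) := by
    have := IsPrimitiveRoot.orderOf ((g : ℂˣ) : ℂ)
    rwa [orderOf_units, Subgroup.orderOf_coe] at this
  -- Every unimodular spectral point is an eigenvalue, hence in `Γ` and killed by the order of the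
  -- generator; minimality of the period applies to that order.
  have hle : d ≤ orderOf g := hmin ⟨orderOf_pos g, fun z hz hz1 => by
    obtain ⟨v, hv0, hv⟩ := hqc.exists_eigenvector (norm_markovOp_le h 2) hz hz1
    obtain ⟨c, f', hf', -⟩ := herg.exists_isUnimodularEigenfunction hz1 hv0 hv
    have hz0 : z ≠ 0 := norm_ne_zero_iff.1 (by rw [hz1]; exact one_ne_zero)
    have hmem : Units.mk0 z hz0 ∈ Γ := ⟨f', hf'⟩
    have := orderOf_dvd_iff_pow_eq_one.1 (orderOf_dvd_of_mem_zpowers (hg ⟨_, hmem⟩))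
    simpa using congrArg (fun u : Γ => ((u : ℂˣ) : ℂ)) this⟩
  have heq : orderOf g = d := Nat.le_antisymm
    (Nat.le_of_dvd (by omega) (hg'.dvd_of_pow_eq_one _ hgd)) hle
  exact ⟨_, f, heq ▸ hg', hf⟩

lemma pow_val_add_one {d : ℕ} [NeZero d] {ζ : ℂ} (hζ : ζ ^ d = 1) (j : ZMod d) :
    ζ ^ (j + 1).val = ζ ^ j.val * ζ := by
  rw [← pow_succ, pow_eq_pow_mod _ hζ, pow_eq_pow_mod (j.val + 1) hζ]
  congr 1
  rw [ZMod.val_add, ZMod.val_one_eq_one_mod]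
  simp

/-- An ergodic quasi-compact Markov operator of period `d` has a cyclic index in `ℤ/d`. -/
lemma IsErgodic.exists_isCyclicIndex {h : Kernel.Invariant κ μ} (herg : IsErgodic κ μ h)
    (hqc : IsQuasiCompact (markovOp κ μ h 2)) {d : ℕ} (hper : IsPeriod (markovOp κ μ h 2) d) :
    ∃ φ : S → ZMod d, IsCyclicIndex κ μ φ := by
  obtain ⟨η, f₀, hη, hf₀⟩ := herg.exists_isPrimitiveRoot hqc hper
  have hd : 0 < d := hper.1.1
  have : NeZero d := ⟨hd.ne'⟩
  -- The power `f₀ ^ d` has eigenvalue one, so it is a constant `c`; dividing `f₀` by a `d`-th root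
  -- of `c` makes its values `d`-th roots of unity.
  have hpow := hf₀.pow d
  rw [hη.pow_eq_one] at hpow
  obtain ⟨c, hc⟩ := herg.ae_const (hpow.memLp ∞)
    (by simpa only [one_mul] using! hpow.markovFun_ae_eq)
  obtain ⟨r, hr⟩ := IsAlgClosed.exists_pow_nat_eq c hd
  -- The inverse root makes the index decrease along transitions, so that `P` raises the index of a
  -- class by one.
  set ζ := η⁻¹ with hζη
  have hζ : IsPrimitiveRoot ζ d := hη.inv
  have hζ0 : ζ ≠ 0 := hζ.ne_zero hd.ne'
  set f : S → ℂ := fun x => r⁻¹ * f₀ x with hfdef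
  have hfm : Measurable f := hf₀.measurable.const_mul _
  have hfd : ∀ᵐ x ∂μ, f x ^ d = 1 := by
    filter_upwards [hc, hf₀.norm_eq_one] with x h1 h2
    rw [Pi.pow_apply] at h1
    have h3 : f₀ x ≠ 0 := norm_ne_zero_iff.1 (by rw [h2]; exact one_ne_zero)
    rw [hfdef, mul_pow, inv_pow, hr, ← h1, inv_mul_cancel₀ (pow_ne_zero _ h3)]
  have hfstep : ∀ᵐ w ∂(μ ⊗ₘ κ), f w.1 = f w.2 * ζ := by
    filter_upwards [hf₀.cocycle] with w hw
    simp only [hfdef, hw, hζη]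
    rw [mul_comm η, ← mul_assoc, mul_inv_cancel_right₀ (hη.ne_zero hd.ne')]
  have hinj : ∀ i j : ZMod d, ζ ^ i.val = ζ ^ j.val → i = j := fun i j hij =>
    ZMod.val_injective d (hζ.pow_inj (ZMod.val_lt i) (ZMod.val_lt j) hij)
  classical
  -- Discrete logarithm to base `ζ`, with default value `0`. A preimage that avoids `0` is therefore
  -- a finite set of roots of unity, and complements give measurability in the other case.
  let ψ : ℂ → ZMod d := fun w => if hw : ∃ j : ZMod d, ζ ^ j.val = w then hw.choose else 0
  have hψ : ∀ w : ℂ, w ^ d = 1 → ζ ^ (ψ w).val = w := fun w hw => by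
    obtain ⟨i, hi, hiw⟩ := hζ.eq_pow_of_pow_eq_one hw
    have hex : ∃ j : ZMod d, ζ ^ j.val = w := ⟨i, by rw [ZMod.val_natCast_of_lt hi, hiw]⟩
    simp only [ψ, dif_pos hex]
    exact hex.choose_spec
  have hψ0 : ∀ J : Set (ZMod d), (0 : ZMod d) ∉ J → MeasurableSet (ψ ⁻¹' J) := fun J hJ => by
    refine ((Set.finite_range fun j : ZMod d => ζ ^ j.val).subset fun w hw => ?_).measurableSet
    by_contra hcon
    have hne : ¬ ∃ j : ZMod d, ζ ^ j.val = w := hcon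
    rw [Set.mem_preimage] at hw
    simp only [ψ, dif_neg hne] at hw
    exact hJ hw
  have hψm : Measurable ψ := fun J _ => by
    by_cases hJ : (0 : ZMod d) ∈ J
    · rw [← compl_compl J, Set.preimage_compl]
      exact (hψ0 Jᶜ fun h0 => h0 hJ).compl
    · exact hψ0 J hJ
  refine ⟨ψ ∘ f, hψm.comp hfm, ?_⟩
  filter_upwards [hfstep, ae_fst hfd, ae_snd h hfd] with w h1 h2 h3
  refine hinj _ _ ?_
  rw [pow_val_add_one hζ.pow_eq_one, Function.comp_apply, Function.comp_apply, hψ _ h2, hψ _ h3,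
    h1]

namespace IsCyclicIndex

variable {d : ℕ} [NeZero d] {φ : S → ZMod d}

lemma measurableSet_preimage (hφ : IsCyclicIndex κ μ φ) (J : Set (ZMod d)) :
    MeasurableSet (φ ⁻¹' J) :=
  hφ.measurable (MeasurableSpace.measurableSet_top)

lemma mem_iff (hφ : IsCyclicIndex κ μ φ) (J : Set (ZMod d)) :
    ∀ᵐ w ∂(μ ⊗ₘ κ), w.2 ∈ φ ⁻¹' J ↔ w.1 ∈ φ ⁻¹' {j | j - 1 ∈ J} := by
  filter_upwards [hφ.step] with w hw
  simp [hw]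

/-- Every `d`-th root of unity is an eigenvalue, with a function of the index as eigenfunction. -/
lemma isUnimodularEigenfunction (hφ : IsCyclicIndex κ μ φ) {z : ℂ} (hz : z ^ d = 1) :
    IsUnimodularEigenfunction κ μ z fun x => z⁻¹ ^ (φ x).val := by
  have hz1 : ‖z‖ = 1 := Complex.norm_eq_one_of_pow_eq_one hz (NeZero.ne d)
  have hz0 : z ≠ 0 := norm_ne_zero_iff.1 (by rw [hz1]; exact one_ne_zero)
  refine ⟨(measurable_from_top (f := fun j : ZMod d => z⁻¹ ^ j.val)).comp hφ.measurable,
    .of_forall fun x => by simp [hz1], ?_⟩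
  filter_upwards [hφ.step] with w hw
  rw [hw, pow_val_add_one (by rw [inv_pow, hz, inv_one]), mul_comm, inv_mul_cancel_right₀ hz0]

/-- Both marginals of `μ ⊗ₘ κ` are `μ`, and a transition starts in class `j + 1` exactly when it
ends in class `j`. So the `d` classes have equal mass. -/
lemma measureReal_preimage (h : Kernel.Invariant κ μ) (hφ : IsCyclicIndex κ μ φ) (j : ZMod d) :
    μ.real (φ ⁻¹' {j}) = (d : ℝ)⁻¹ := by
  have hstep : ∀ j, μ.real (φ ⁻¹' {j + 1}) = μ.real (φ ⁻¹' {j}) := fun j => by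
    have h1 := (measurePreserving_fst (κ := κ) (μ := μ)).measure_preimage
      (hφ.measurableSet_preimage {j + 1}).nullMeasurableSet
    have h2 := (measurePreserving_snd (κ := κ) h).measure_preimage
      (hφ.measurableSet_preimage {j}).nullMeasurableSet
    rw [measureReal_def, measureReal_def, ← h1, ← h2]
    congr 1
    refine measure_congr ?_
    filter_upwards [hφ.step] with w hw
    refine propext ?_
    change φ w.1 = j + 1 ↔ φ w.2 = j
    rw [hw, add_left_inj]
  have hnat : ∀ n : ℕ, μ.real (φ ⁻¹' {(n : ZMod d)}) = μ.real (φ ⁻¹' {0}) := fun n => by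
    induction n with
    | zero => simp
    | succ n ih => rw [Nat.cast_succ, hstep, ih]
  have hall : ∀ i : ZMod d, μ.real (φ ⁻¹' {i}) = μ.real (φ ⁻¹' {0}) := fun i => by
    rw [← hnat i.val, ZMod.natCast_zmod_val]
  have hsum : ∑ i : ZMod d, μ.real (φ ⁻¹' {i}) = 1 := by
    rw [sum_measureReal_preimage_singleton _ fun i _ => hφ.measurableSet_preimage {i}]
    simp
  simp only [hall, Finset.sum_const, Finset.card_univ, ZMod.card, nsmul_eq_mul] at hsum
  rw [hall j]
  exact eq_inv_of_mul_eq_one_right hsum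

lemma markovOp_pow_ind (h : Kernel.Invariant κ μ) (hφ : IsCyclicIndex κ μ φ) (p : ℝ≥0∞)
    [hp : Fact (1 ≤ p)] (J : Set (ZMod d)) (n : ℕ) :
    (markovOp κ μ h p ^ n) (ind μ p (φ ⁻¹' J) (hφ.measurableSet_preimage J)) =
      ind μ p (φ ⁻¹' {j | j - n ∈ J}) (hφ.measurableSet_preimage _) := by
  induction n with
  | zero => simp
  | succ n ih =>
    rw [pow_succ', mul_apply_eq_comp, ih,
      markovOp_ind h p _ (hφ.measurableSet_preimage _) (hφ.mem_iff _)]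
    refine ind_congr _ _ (congrArg _ (Set.ext fun j => ?_))
    simp [sub_sub, add_comm]

lemma dualOp_pow_ind (h : Kernel.Invariant κ μ) (hφ : IsCyclicIndex κ μ φ) (p : ℝ≥0∞)
    [hp : Fact (1 ≤ p)] (J : Set (ZMod d)) (n : ℕ) :
    (dualOp κ μ h p ^ n) (ind μ p (φ ⁻¹' J) (hφ.measurableSet_preimage J)) =
      ind μ p (φ ⁻¹' {j | j + n ∈ J}) (hφ.measurableSet_preimage _) := by
  induction n with
  | zero => simp
  | succ n ih =>
    rw [pow_succ', mul_apply_eq_comp, ih]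
    refine dualOp_ind h p _ _ ?_
    refine (hφ.mem_iff _).mono fun w hw => hw.trans ?_
    simp

lemma markovOp_pow_ind_singleton (h : Kernel.Invariant κ μ) (hφ : IsCyclicIndex κ μ φ)
    (p : ℝ≥0∞) [hp : Fact (1 ≤ p)] (l : ZMod d) (n : ℕ) :
    (markovOp κ μ h p ^ n) (ind μ p (φ ⁻¹' {l}) (hφ.measurableSet_preimage _)) =
      ind μ p (φ ⁻¹' {l + n}) (hφ.measurableSet_preimage _) := by
  rw [hφ.markovOp_pow_ind]
  refine ind_congr _ _ (congrArg _ (Set.ext fun j => ?_))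
  simp [sub_eq_iff_eq_add]

lemma dualOp_pow_ind_singleton (h : Kernel.Invariant κ μ) (hφ : IsCyclicIndex κ μ φ)
    (p : ℝ≥0∞) [hp : Fact (1 ≤ p)] (l : ZMod d) (n : ℕ) :
    (dualOp κ μ h p ^ n) (ind μ p (φ ⁻¹' {l}) (hφ.measurableSet_preimage _)) =
      ind μ p (φ ⁻¹' {l - n}) (hφ.measurableSet_preimage _) := by
  rw [hφ.dualOp_pow_ind]
  refine ind_congr _ _ (congrArg _ (Set.ext fun j => ?_))
  simp [eq_sub_iff_add_eq]

end IsCyclicIndex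

end Index

lemma mem_orthogonal_span_range {H ι : Type*} [NormedAddCommGroup H] [InnerProductSpace ℂ H]
    {v : ι → H} {x : H} :
    x ∈ (Submodule.span ℂ (Set.range v))ᗮ ↔ ∀ i, inner ℂ (v i) x = 0 := by
  rw [Submodule.mem_orthogonal]
  refine ⟨fun h i => h _ (Submodule.subset_span ⟨i, rfl⟩), fun h u hu => ?_⟩
  induction hu using Submodule.span_induction with
  | mem u hu => obtain ⟨i, rfl⟩ := hu; exact h i
  | zero => exact inner_zero_left _
  | add u w _ _ hu hw => rw [inner_add_left, hu, hw, add_zero]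
  | smul c u _ hu => rw [inner_smul_left, hu, mul_zero]

/-! ### Convergence in `L²` -/

section Limit

variable {S : Type*} [MeasurableSpace S] {κ : Kernel S S} [IsMarkovKernel κ] {μ : Measure S}
  [IsProbabilityMeasure μ]

/-- The dual Markov operator on `L²` is the Hilbert space adjoint. -/
lemma adjoint_markovOp (h : Kernel.Invariant κ μ) :
    ContinuousLinearMap.adjoint (markovOp κ μ h 2) = dualOp κ μ h 2 := by
  ext1 f
  set g := ContinuousLinearMap.adjoint (markovOp κ μ h 2) f
  have hf : Integrable f μ := (Lp.memLp f).integrable (by norm_num)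
  have hF : Integrable (fun w : S × S => f w.1) (μ ⊗ₘ κ) :=
    measurePreserving_fst.integrable_comp_of_integrable hf
  refine (Lp.ext ((coeFn_dualOp h f).trans (dualFun_ae_eq h hf
    ((Lp.memLp g).integrable (by norm_num)) fun A hA => ?_))).symm
  -- Tested on `1_A`, both sides are `∫ κ(x, A) f(x) dμ(x)`, because `P 1_A = κ(·, A)`.
  rw [← L2.inner_indicatorConstLp_one (𝕜 := ℂ) hA (measure_ne_top μ A) g,
    ContinuousLinearMap.adjoint_inner_right, L2.inner_def, ← Set.univ_prod,
    Measure.setIntegral_compProd MeasurableSet.univ hA hF.integrableOn, Measure.restrict_univ]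
  refine integral_congr_ae ?_
  filter_upwards [coeFn_markovOp h (ind μ 2 A hA), markovFun_congr h (coeFn_ind (p := 2) hA)]
    with x h1 h2
  have h3 : markovOp κ μ h 2 (indicatorConstLp 2 hA (measure_ne_top μ A) 1) x
      = (((κ x).real A : ℝ) : ℂ) := by
    refine (h1.trans h2).trans ?_
    rw [markovFun, integral_indicator_const _ hA]
    simp
  rw [h3]
  simp [RCLike.inner_apply, mul_comm]

/-- The functional `f ↦ ∫_A f dμ` on `L^p`. -/
noncomputable def setIntegralCLM (μ : Measure S) [IsProbabilityMeasure μ] (p : ℝ≥0∞)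
    [hp : Fact (1 ≤ p)] (A : Set S) : Lp ℂ p μ →L[ℂ] ℂ :=
  LinearMap.mkContinuous
    { toFun := fun f => ∫ x in A, f x ∂μ
      map_add' := fun f g => by
        rw [← integral_add ((Lp.memLp f).integrable hp.out).integrableOn
          ((Lp.memLp g).integrable hp.out).integrableOn]
        exact integral_congr_ae (ae_restrict_of_ae (Lp.coeFn_add f g))
      map_smul' := fun c f => by
        rw [RingHom.id_apply, ← integral_smul]
        exact integral_congr_ae (ae_restrict_of_ae (Lp.coeFn_smul c f)) }
    1 fun f => by
      have hf := (Lp.memLp f).integrable hp.out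
      rw [one_mul]
      calc ‖∫ x in A, f x ∂μ‖ ≤ ∫ x in A, ‖f x‖ ∂μ := norm_integral_le_integral_norm _
        _ ≤ ∫ x, ‖f x‖ ∂μ := setIntegral_le_integral hf.norm (.of_forall fun x => norm_nonneg _)
        _ = (eLpNorm f 1 μ).toReal := by
          rw [integral_norm_eq_lintegral_enorm hf.1, eLpNorm_one_eq_lintegral_enorm]
        _ ≤ ‖f‖ := by
          rw [Lp.norm_def]
          exact ENNReal.toReal_mono (Lp.memLp f).2.ne
            (eLpNorm_le_eLpNorm_of_exponent_le hp.out hf.1)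

lemma setIntegralCLM_apply (p : ℝ≥0∞) [hp : Fact (1 ≤ p)] (A : Set S) (f : Lp ℂ p μ) :
    setIntegralCLM μ p A f = ∫ x in A, f x ∂μ := rfl

/-- The operator `f ↦ d ∑_l (∫_{φ = l} f dμ) 1_{φ = l + j}` on `L^p`. -/
noncomputable def cyclicLimit (μ : Measure S) [IsProbabilityMeasure μ] {d : ℕ} [NeZero d]
    {φ : S → ZMod d} (hφ : Measurable φ) (p : ℝ≥0∞) [hp : Fact (1 ≤ p)] (j : ZMod d) :
    Lp ℂ p μ →L[ℂ] Lp ℂ p μ :=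
  (d : ℂ) • ∑ l : ZMod d, (setIntegralCLM μ p (φ ⁻¹' {l})).smulRight
    (ind μ p (φ ⁻¹' {l + j}) (hφ MeasurableSpace.measurableSet_top))

lemma cyclicLimit_apply {d : ℕ} [NeZero d] {φ : S → ZMod d} (hφ : Measurable φ) (p : ℝ≥0∞)
    [hp : Fact (1 ≤ p)] (j : ZMod d) (f : Lp ℂ p μ) :
    cyclicLimit μ hφ p j f = (d : ℂ) • ∑ l : ZMod d, (∫ x in φ ⁻¹' {l}, f x ∂μ) •
      ind μ p (φ ⁻¹' {l + j}) (hφ MeasurableSpace.measurableSet_top) := by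
  simp [cyclicLimit, setIntegralCLM_apply]

namespace IsCyclicIndex

variable {d : ℕ} [NeZero d] {φ : S → ZMod d}

lemma markovOp_pow_cyclicLimit (h : Kernel.Invariant κ μ) (hφ : IsCyclicIndex κ μ φ) (p : ℝ≥0∞)
    [hp : Fact (1 ≤ p)] (f : Lp ℂ p μ) (n : ℕ) :
    (markovOp κ μ h p ^ n) (cyclicLimit μ hφ.measurable p 0 f) =
      cyclicLimit μ hφ.measurable p n f := by
  simp only [cyclicLimit_apply, map_smul, map_sum, hφ.markovOp_pow_ind_singleton, add_zero]

lemma dualOp_pow_cyclicLimit (h : Kernel.Invariant κ μ) (hφ : IsCyclicIndex κ μ φ) (p : ℝ≥0∞)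
    [hp : Fact (1 ≤ p)] (f : Lp ℂ p μ) (n : ℕ) :
    (dualOp κ μ h p ^ n) (cyclicLimit μ hφ.measurable p 0 f) =
      cyclicLimit μ hφ.measurable p (-n) f := by
  simp only [cyclicLimit_apply, map_smul, map_sum, hφ.dualOp_pow_ind_singleton, add_zero,
    sub_eq_add_neg]

/-- The classes are disjoint of mass `1/d`, which the factor `d` cancels. Thus `cyclicLimit` at
shift `0` is the orthogonal projection onto the span of their indicators. -/
lemma inner_cyclicLimit (h : Kernel.Invariant κ μ) (hφ : IsCyclicIndex κ μ φ) (f : Lp ℂ 2 μ)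
    (k : ZMod d) :
    inner ℂ (ind μ 2 (φ ⁻¹' {k}) (hφ.measurableSet_preimage _))
      (cyclicLimit μ hφ.measurable 2 0 f) = ∫ x in φ ⁻¹' {k}, f x ∂μ := by
  have hin : ∀ l : ZMod d, inner ℂ (ind μ 2 (φ ⁻¹' {k}) (hφ.measurableSet_preimage _))
      (ind μ 2 (φ ⁻¹' {l}) (hφ.measurableSet_preimage _)) =
      if l = k then ((d : ℂ)⁻¹) else 0 := fun l => by
    rw [ind, ind, L2.inner_indicatorConstLp_one_indicatorConstLp_one, ← Set.preimage_inter]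
    split_ifs with hlk
    · rw [hlk, Set.inter_self, hφ.measureReal_preimage h]
      simp
    · have : ({k} : Set (ZMod d)) ∩ {l} = ∅ := by
        ext j
        simp only [Set.mem_inter_iff, Set.mem_singleton_iff, Set.mem_empty_iff_false, iff_false]
        rintro ⟨rfl, rfl⟩
        exact hlk rfl
      simp [this]
  have hd : (d : ℂ) ≠ 0 := Nat.cast_ne_zero.2 (NeZero.ne d)
  simp only [cyclicLimit_apply, add_zero, inner_smul_right, inner_sum, hin, mul_ite, mul_zero,
    Finset.sum_ite_eq', Finset.mem_univ, if_true]
  field_simp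

/-- An eigenvector with unimodular eigenvalue whose integrals over the cyclic classes vanish is
zero. -/
lemma eq_zero_of_setIntegral_eq_zero {h : Kernel.Invariant κ μ} (herg : IsErgodic κ μ h)
    (hper : IsPeriod (markovOp κ μ h 2) d) (hφ : IsCyclicIndex κ μ φ) {z : ℂ} (hz : ‖z‖ = 1)
    {v : Lp ℂ 2 μ} (hv : markovOp κ μ h 2 v = z • v)
    (hv0 : ∫ x in φ ⁻¹' {0}, v x ∂μ = 0) : v = 0 := by
  by_contra hne
  obtain ⟨c, f, hf, hvf⟩ := herg.exists_isUnimodularEigenfunction hz hne hv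
  obtain ⟨c', hff⟩ := hf.ae_eq_const_mul herg (hφ.isUnimodularEigenfunction (hf.pow_eq_one hper))
  have hval : ∀ᵐ x ∂μ, v x = c * c' * z⁻¹ ^ (φ x).val := by
    filter_upwards [hvf, hff] with x h1 h2
    rw [h1, h2, mul_assoc]
  -- One class suffices: on class `0` the eigenfunction `z⁻¹ ^ φ` is identically one, so the
  -- integral there detects the coefficient.
  have hC0 : ∫ x in φ ⁻¹' {0}, v x ∂μ = (d : ℂ)⁻¹ * (c * c') := by
    rw [setIntegral_congr_ae (g := fun _ => c * c') (hφ.measurableSet_preimage {0})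
      (hval.mono fun x hx hx0 => ?_), setIntegral_const, hφ.measureReal_preimage h]
    · simp
    · have : φ x = 0 := hx0
      rw [hx, this, ZMod.val_zero, pow_zero, mul_one]
  rw [hv0, eq_comm, mul_eq_zero, inv_eq_zero, Nat.cast_eq_zero, or_iff_right (NeZero.ne d)] at hC0
  refine hne (Lp.ext ?_)
  filter_upwards [hval, Lp.coeFn_zero ℂ 2 μ] with x h1 h2
  rw [h1, h2, hC0, zero_mul, Pi.zero_apply]

/-- The projection of `f` onto the span of the class indicators is merely rotated. The remainder
lies in the orthogonal complement `E`, invariant under `P` because `P*` permutes the indicators and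
under `P*` because `P` does; `E` has no unimodular eigenvectors, so the powers decay on it. -/
lemma tendsto_pow_sub_cyclicLimit_two {h : Kernel.Invariant κ μ} (herg : IsErgodic κ μ h)
    (hqc : IsQuasiCompact (markovOp κ μ h 2)) (hper : IsPeriod (markovOp κ μ h 2) d)
    (hφ : IsCyclicIndex κ μ φ) (f : Lp ℂ 2 μ) :
    Tendsto (fun n : ℕ => ‖(markovOp κ μ h 2 ^ n) f - cyclicLimit μ hφ.measurable 2 n f‖)
      atTop (𝓝 0) ∧
    Tendsto (fun n : ℕ => ‖(dualOp κ μ h 2 ^ n) f - cyclicLimit μ hφ.measurable 2 (-n) f‖)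
      atTop (𝓝 0) := by
  let v : ZMod d → Lp ℂ 2 μ := fun l => ind μ 2 (φ ⁻¹' {l}) (hφ.measurableSet_preimage _)
  have hin : ∀ l (g : Lp ℂ 2 μ), inner ℂ (v l) g = ∫ x in φ ⁻¹' {l}, g x ∂μ := fun l g =>
    L2.inner_indicatorConstLp_one _ _ g
  have hPv : ∀ l, markovOp κ μ h 2 (v l) = v (l + 1) := fun l => by
    simpa using hφ.markovOp_pow_ind_singleton h 2 l 1
  have hDv : ∀ l, dualOp κ μ h 2 (v l) = v (l - 1) := fun l => by
    simpa using hφ.dualOp_pow_ind_singleton h 2 l 1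
  set E : Submodule ℂ (Lp ℂ 2 μ) := (Submodule.span ℂ (Set.range v))ᗮ
  have hE : ∀ g ∈ E, markovOp κ μ h 2 g ∈ E := fun g hg => by
    rw [mem_orthogonal_span_range] at hg ⊢
    intro l
    rw [← ContinuousLinearMap.adjoint_inner_left, adjoint_markovOp, hDv, hg]
  have hE' : ∀ g ∈ E, ContinuousLinearMap.adjoint (markovOp κ μ h 2) g ∈ E := fun g hg => by
    rw [mem_orthogonal_span_range] at hg ⊢
    intro l
    rw [ContinuousLinearMap.adjoint_inner_right, hPv, hg]
  have hlim := hqc.tendsto_norm_pow_mul_starProjection (norm_markovOp_le h 2) hE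
    fun z hz g hg hgz => hφ.eq_zero_of_setIntegral_eq_zero herg hper hz hgz
      (by rw [← hin]; exact mem_orthogonal_span_range.1 hg 0)
  have hmem : f - cyclicLimit μ hφ.measurable 2 0 f ∈ E := by
    rw [mem_orthogonal_span_range]
    intro l
    rw [inner_sub_right, hin, hφ.inner_cyclicLimit h, sub_self]
  constructor
  · refine (tendsto_norm_pow_apply_of_mem hlim hmem).congr fun n => ?_
    rw [map_sub, hφ.markovOp_pow_cyclicLimit]
  · refine (tendsto_norm_adjoint_pow_apply_of_mem hE' hlim hmem).congr fun n => ?_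
    rw [adjoint_markovOp, map_sub, hφ.dualOp_pow_cyclicLimit]

end IsCyclicIndex

end Limit

/-! ### From `L²` to `L^p` -/

section Transfer

variable {S : Type*} [MeasurableSpace S] {μ : Measure S}

/-- For uniformly bounded functions, convergence to zero in `L¹` implies it in `L^p`. -/
lemma tendsto_eLpNorm_of_bounded {g : ℕ → S → ℂ} {M : ℝ≥0∞} (hM : M ≠ ∞)
    (hg : ∀ n, ∀ᵐ x ∂μ, ‖g n x‖ₑ ≤ M)
    (h1 : Tendsto (fun n => eLpNorm (g n) 1 μ) atTop (𝓝 0)) {p : ℝ≥0∞} (hp : 1 ≤ p)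
    (hp' : p ≠ ∞) : Tendsto (fun n => eLpNorm (g n) p μ) atTop (𝓝 0) := by
  have hp0 : p ≠ 0 := (zero_lt_one.trans_le hp).ne'
  set q := p.toReal with hq
  have hq1 : 1 ≤ q := by
    rw [hq, ← ENNReal.toReal_one]
    exact ENNReal.toReal_mono hp' hp
  have hMq : M ^ (q - 1) ≠ ∞ := ENNReal.rpow_ne_top_of_nonneg (by linarith) hM
  have hlim : Tendsto (fun n => (M ^ (q - 1) * eLpNorm (g n) 1 μ) ^ (1 / q)) atTop (𝓝 0) := by
    have h2 := ENNReal.Tendsto.const_mul h1 (Or.inr hMq)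
    have h3 := ((ENNReal.continuous_rpow_const (y := 1 / q)).tendsto _).comp h2
    rwa [mul_zero, ENNReal.zero_rpow_of_pos (by positivity)] at h3
  refine tendsto_of_tendsto_of_tendsto_of_le_of_le tendsto_const_nhds hlim
    (fun n => zero_le) fun n => ?_
  dsimp only
  rw [eLpNorm_eq_lintegral_rpow_enorm_toReal hp0 hp', eLpNorm_one_eq_lintegral_enorm,
    ← lintegral_const_mul' _ _ hMq]
  refine ENNReal.rpow_le_rpow (lintegral_mono_ae ?_) (by positivity)
  filter_upwards [hg n] with x hx
  calc ‖g n x‖ₑ ^ q = ‖g n x‖ₑ ^ (q - 1) * ‖g n x‖ₑ := by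
        conv_lhs => rw [← sub_add_cancel q 1]
        rw [ENNReal.rpow_add_of_nonneg _ _ (by linarith) zero_le_one, ENNReal.rpow_one]
    _ ≤ M ^ (q - 1) * ‖g n x‖ₑ := by
        gcongr

/-- For a uniformly bounded sequence of operators, pointwise convergence to zero is a closed
condition. -/
lemma isClosed_setOf_tendsto_norm_apply {X : Type*} [NormedAddCommGroup X] [NormedSpace ℂ X]
    {U : ℕ → X →L[ℂ] X} {C : ℝ} (hC : ∀ n, ‖U n‖ ≤ C) :
    IsClosed {f : X | Tendsto (fun n => ‖U n f‖) atTop (𝓝 0)} := by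
  have hC0 : 0 ≤ C := (norm_nonneg _).trans (hC 0)
  refine isClosed_of_closure_subset fun f hf => ?_
  rw [Set.mem_ofPred_eq, Metric.tendsto_atTop]
  intro ε hε
  obtain ⟨g, hg, hfg⟩ := Metric.mem_closure_iff.1 hf (ε / (2 * (C + 1))) (by positivity)
  obtain ⟨N, hN⟩ := Metric.tendsto_atTop.1 hg (ε / 2) (half_pos hε)
  refine ⟨N, fun n hn => ?_⟩
  have h1 := hN n hn
  simp only [dist_zero_right, norm_norm] at h1 ⊢
  have h2 : ‖U n (f - g)‖ ≤ ε / 2 := by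
    calc ‖U n (f - g)‖ ≤ (C + 1) * (ε / (2 * (C + 1))) :=
          (U n).le_of_opNorm_le_of_le ((hC n).trans (by linarith))
            (by rw [← dist_eq_norm]; exact hfg.le)
      _ = ε / 2 := by field_simp
  calc ‖U n f‖ = ‖U n (f - g) + U n g‖ := by rw [← map_add, sub_add_cancel]
    _ ≤ ‖U n (f - g)‖ + ‖U n g‖ := norm_add_le _ _
    _ < ε := by linarith

variable [IsProbabilityMeasure μ]

/-- Consistent bounded operators on all `L^p` which tend to zero strongly on `L²` do so on every
`L^p` with `p < ∞`. -/
lemma tendsto_Lp_of_tendsto_two (U : ∀ (p : ℝ≥0∞) [Fact (1 ≤ p)], ℕ → Lp ℂ p μ →L[ℂ] Lp ℂ p μ)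
    (hC : ∀ (p : ℝ≥0∞) [Fact (1 ≤ p)], ∃ C, ∀ n, ‖U p n‖ ≤ C)
    (hU : ∀ (p q : ℝ≥0∞) [Fact (1 ≤ p)] [Fact (1 ≤ q)] (f : Lp ℂ p μ) (g : Lp ℂ q μ),
      f =ᵐ[μ] g → ∀ n, U p n f =ᵐ[μ] U q n g)
    (h2 : ∀ f : Lp ℂ 2 μ, Tendsto (fun n => ‖U 2 n f‖) atTop (𝓝 0))
    (p : ℝ≥0∞) [hp : Fact (1 ≤ p)] (hp' : p ≠ ∞) (f : Lp ℂ p μ) :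
    Tendsto (fun n => ‖U p n f‖) atTop (𝓝 0) := by
  induction f using Lp.induction hp' with
  | indicatorConst c hs hμs =>
    rename_i s
    rw [Lp.simpleFunc.coe_indicatorConst]
    -- The same function viewed in every `L^q`: its `L^∞` version bounds the images uniformly, its
    -- `L²` version gives convergence in `L¹`, and together these give `L^p`.
    let f (q : ℝ≥0∞) : Lp ℂ q μ := indicatorConstLp q hs hμs.ne c
    have hf : ∀ q r, f q =ᵐ[μ] f r := fun q r =>
      indicatorConstLp_coeFn.trans indicatorConstLp_coeFn.symm
    obtain ⟨C, hC⟩ := hC ∞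
    have hbound : ∀ n, ∀ᵐ x ∂μ, ‖U p n (f p) x‖ₑ ≤ ENNReal.ofReal (C * ‖f ∞‖) := fun n => by
      filter_upwards [hU p ∞ (f p) (f ∞) (hf _ _) n,
        enorm_ae_le_eLpNormEssSup (U ∞ n (f ∞)) μ] with x hx1 hx2
      rw [hx1]
      refine hx2.trans ?_
      rw [← eLpNorm_exponent_top, ← Lp.enorm_def, ← ofReal_norm]
      exact ENNReal.ofReal_le_ofReal ((U ∞ n).le_of_opNorm_le (hC n) _)
    have hone : Tendsto (fun n => eLpNorm (U p n (f p)) 1 μ) atTop (𝓝 0) := by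
      have h3 := (ENNReal.tendsto_ofReal (h2 (f 2)))
      rw [ENNReal.ofReal_zero] at h3
      refine tendsto_of_tendsto_of_tendsto_of_le_of_le tendsto_const_nhds h3
        (fun n => zero_le) fun n => ?_
      dsimp only
      rw [ofReal_norm, Lp.enorm_def, eLpNorm_congr_ae (hU p 2 (f p) (f 2) (hf _ _) n)]
      exact eLpNorm_le_eLpNorm_of_exponent_le (by norm_num) (Lp.aestronglyMeasurable _)
    have h4 := tendsto_eLpNorm_of_bounded ENNReal.ofReal_ne_top hbound hone hp.out hp'
    have h5 := (ENNReal.tendsto_toReal ENNReal.zero_ne_top).comp h4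
    exact h5.congr fun n => (Lp.norm_def _).symm
  | add hf hg _ hf' hg' =>
    refine squeeze_zero (fun n => norm_nonneg _) (fun n => ?_) (by simpa using hf'.add hg')
    rw [map_add]
    exact norm_add_le _ _
  | isClosed =>
    obtain ⟨C, hC⟩ := hC p
    exact isClosed_setOf_tendsto_norm_apply hC

variable {κ : Kernel S S} [IsMarkovKernel κ]

lemma markovOp_pow_ae_congr (h : Kernel.Invariant κ μ) {p q : ℝ≥0∞} [Fact (1 ≤ p)]
    [Fact (1 ≤ q)] {f : Lp ℂ p μ} {g : Lp ℂ q μ} (hfg : f =ᵐ[μ] g) (n : ℕ) :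
    (markovOp κ μ h p ^ n) f =ᵐ[μ] (markovOp κ μ h q ^ n) g := by
  induction n with
  | zero => simpa using hfg
  | succ n ih =>
    simp only [pow_succ', mul_apply_eq_comp]
    exact ((coeFn_markovOp h _).trans (markovFun_congr h ih)).trans (coeFn_markovOp h _).symm

lemma dualOp_pow_ae_congr (h : Kernel.Invariant κ μ) {p q : ℝ≥0∞} [Fact (1 ≤ p)]
    [Fact (1 ≤ q)] {f : Lp ℂ p μ} {g : Lp ℂ q μ} (hfg : f =ᵐ[μ] g) (n : ℕ) :
    (dualOp κ μ h p ^ n) f =ᵐ[μ] (dualOp κ μ h q ^ n) g := by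
  induction n with
  | zero => simpa using hfg
  | succ n ih =>
    simp only [pow_succ', mul_apply_eq_comp]
    refine (coeFn_dualOp h _).trans ?_
    rw [dualFun_congr ih]
    exact (coeFn_dualOp h _).symm

variable {d : ℕ} [NeZero d] {φ : S → ZMod d}

/-- Only the summand `l = φ x - j` survives at `x`. The pointwise formula shows that the operators
on different `L^p` are consistent. -/
lemma coeFn_cyclicLimit (hφ : Measurable φ) (p : ℝ≥0∞) [Fact (1 ≤ p)] (j : ZMod d)
    (f : Lp ℂ p μ) :
    cyclicLimit μ hφ p j f =ᵐ[μ] fun x => (d : ℂ) * ∫ y in φ ⁻¹' {φ x - j}, f y ∂μ := by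
  rw [cyclicLimit_apply]
  refine (Lp.coeFn_smul _ _).trans ?_
  have hsm : ∀ l : ZMod d, ∀ᵐ x ∂μ, ((∫ y in φ ⁻¹' {l}, f y ∂μ) •
      ind μ p (φ ⁻¹' {l + j}) (hφ MeasurableSpace.measurableSet_top)) x =
        if φ x - j = l then ∫ y in φ ⁻¹' {l}, f y ∂μ else 0 := fun l => by
    filter_upwards [Lp.coeFn_smul (∫ y in φ ⁻¹' {l}, f y ∂μ)
      (ind μ p (φ ⁻¹' {l + j}) (hφ MeasurableSpace.measurableSet_top)),
      coeFn_ind (μ := μ) (p := p) (A := φ ⁻¹' {l + j}) (hφ MeasurableSpace.measurableSet_top)]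
      with x h1 h2
    rw [h1, Pi.smul_apply, h2]
    by_cases hx : φ x = l + j <;> simp [Set.indicator, hx, sub_eq_iff_eq_add]
  filter_upwards [Lp.coeFn_fun_finsetSum Finset.univ fun l : ZMod d =>
    (∫ y in φ ⁻¹' {l}, f y ∂μ) • ind μ p (φ ⁻¹' {l + j}) (hφ MeasurableSpace.measurableSet_top),
    ae_all_iff.2 hsm] with x h1 h2
  rw [Pi.smul_apply, h1, smul_eq_mul]
  simp only [h2, Finset.sum_ite_eq, Finset.mem_univ, if_true]

lemma cyclicLimit_ae_congr (hφ : Measurable φ) {p q : ℝ≥0∞} [Fact (1 ≤ p)] [Fact (1 ≤ q)]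
    (j : ZMod d) {f : Lp ℂ p μ} {g : Lp ℂ q μ} (hfg : f =ᵐ[μ] g) :
    cyclicLimit μ hφ p j f =ᵐ[μ] cyclicLimit μ hφ q j g := by
  filter_upwards [coeFn_cyclicLimit hφ p j f, coeFn_cyclicLimit hφ q j g] with x h1 h2
  rw [h1, h2, integral_congr_ae (ae_restrict_of_ae hfg)]

/-- The shifts `a n` range over the finite set `ℤ/d`, so the sum of all the limit norms is a uniform
bound. -/
lemma exists_norm_pow_sub_cyclicLimit_le (hφ : Measurable φ) {p : ℝ≥0∞} [Fact (1 ≤ p)]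
    {T : Lp ℂ p μ →L[ℂ] Lp ℂ p μ} (hT : ‖T‖ ≤ 1) (a : ℕ → ZMod d) :
    ∃ C, ∀ n, ‖T ^ n - cyclicLimit μ hφ p (a n)‖ ≤ C := by
  have hpow : ∀ n, ‖T ^ n‖ ≤ 1 := fun n =>
    ContinuousLinearMap.opNorm_le_bound _ zero_le_one fun f => by
      rw [one_mul]
      induction n with
      | zero => simp
      | succ n ih =>
        rw [pow_succ', mul_apply_eq_comp]
        refine le_trans ?_ ih
        simpa using T.le_of_opNorm_le hT ((T ^ n) f)
  refine ⟨1 + ∑ j : ZMod d, ‖cyclicLimit μ hφ p j‖, fun n => (norm_sub_le _ _).trans ?_⟩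
  exact add_le_add (hpow n) (Finset.single_le_sum (f := fun j => ‖cyclicLimit μ hφ p j‖)
    (fun j _ => norm_nonneg _) (Finset.mem_univ (a n)))

namespace IsCyclicIndex

lemma tendsto_pow_sub_cyclicLimit {h : Kernel.Invariant κ μ} (herg : IsErgodic κ μ h)
    (hqc : IsQuasiCompact (markovOp κ μ h 2)) (hper : IsPeriod (markovOp κ μ h 2) d)
    (hφ : IsCyclicIndex κ μ φ) (p : ℝ≥0∞) [Fact (1 ≤ p)] (hp : p ≠ ∞) (f : Lp ℂ p μ) :
    Tendsto (fun n : ℕ => ‖(markovOp κ μ h p ^ n) f - cyclicLimit μ hφ.measurable p n f‖)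
      atTop (𝓝 0) ∧
    Tendsto (fun n : ℕ => ‖(dualOp κ μ h p ^ n) f - cyclicLimit μ hφ.measurable p (-n) f‖)
      atTop (𝓝 0) := by
  constructor
  · refine tendsto_Lp_of_tendsto_two
      (fun p _ n => markovOp κ μ h p ^ n - cyclicLimit μ hφ.measurable p n)
      (fun p _ => exists_norm_pow_sub_cyclicLimit_le _ (norm_markovOp_le h p) _)
      (fun p q _ _ f g hfg n => ?_)
      (fun f => (hφ.tendsto_pow_sub_cyclicLimit_two herg hqc hper f).1) p hp f
    simp only [sub_apply]
    exact (Lp.coeFn_sub _ _).trans (((markovOp_pow_ae_congr h hfg n).sub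
      (cyclicLimit_ae_congr _ _ hfg)).trans (Lp.coeFn_sub _ _).symm)
  · refine tendsto_Lp_of_tendsto_two
      (fun p _ n => dualOp κ μ h p ^ n - cyclicLimit μ hφ.measurable p (-n))
      (fun p _ => exists_norm_pow_sub_cyclicLimit_le _ (norm_dualOp_le h p) _)
      (fun p q _ _ f g hfg n => ?_)
      (fun f => (hφ.tendsto_pow_sub_cyclicLimit_two herg hqc hper f).2) p hp f
    simp only [sub_apply]
    exact (Lp.coeFn_sub _ _).trans (((dualOp_pow_ae_congr h hfg n).sub
      (cyclicLimit_ae_congr _ _ hfg)).trans (Lp.coeFn_sub _ _).symm)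

end IsCyclicIndex

end Transfer

/-! ### The `σ`-algebra of `P^d`-invariant sets and the eigenvalues on `L^p` -/

section InvariantSets

variable {S : Type*} [MeasurableSpace S] {κ : Kernel S S} [IsMarkovKernel κ] {μ : Measure S}
  [IsProbabilityMeasure μ] {d : ℕ} [NeZero d] {φ : S → ZMod d}

lemma pow_mul_apply_eq_self {X : Type*} [NormedAddCommGroup X] [NormedSpace ℂ X]
    {T : X →L[ℂ] X} {v : X} {k : ℕ} (hv : (T ^ k) v = v) (n : ℕ) : (T ^ (n * k)) v = v := by
  induction n with
  | zero => simp
  | succ n ih => rw [Nat.succ_mul, pow_add, mul_apply_eq_comp, hv, ih]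

lemma sum_range_natCast_zmod {M : Type*} [AddCommMonoid M] (F : ZMod d → M) :
    ∑ l ∈ Finset.range d, F l = ∑ j : ZMod d, F j := by
  refine Finset.sum_bij (fun l _ => (l : ZMod d)) (fun _ _ => Finset.mem_univ _)
    (fun a ha b hb hab => ?_) (fun j _ => ⟨j.val, Finset.mem_range.2 (ZMod.val_lt j),
      ZMod.natCast_zmod_val j⟩) fun _ _ => rfl
  have := congrArg ZMod.val hab
  rwa [ZMod.val_natCast_of_lt (Finset.mem_range.1 ha),
    ZMod.val_natCast_of_lt (Finset.mem_range.1 hb)] at this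

namespace IsCyclicIndex

/-- The `P^d`-invariant sets are, modulo null sets, the sets defined by the cyclic index. -/
lemma mem_invariantSets_iff {h : Kernel.Invariant κ μ} (herg : IsErgodic κ μ h)
    (hqc : IsQuasiCompact (markovOp κ μ h 2)) (hper : IsPeriod (markovOp κ μ h 2) d)
    (hφ : IsCyclicIndex κ μ φ) {B : Set S} :
    B ∈ invariantSets κ μ h d ↔ MeasurableSet B ∧ ∃ J : Set (ZMod d), B =ᵐ[μ] φ ⁻¹' J := by
  constructor
  · rintro ⟨hB, hinv⟩
    refine ⟨hB, ?_⟩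
    have hcoe : ind μ 2 B hB =ᵐ[μ] ind μ ∞ B hB := (coeFn_ind hB).trans (coeFn_ind hB).symm
    have hinv2 : (markovOp κ μ h 2 ^ d) (ind μ 2 B hB) = ind μ 2 B hB :=
      Lp.ext ((markovOp_pow_ae_congr h hcoe d).trans (by rw [hinv]; exact hcoe.symm))
    have hlim := ((hφ.tendsto_pow_sub_cyclicLimit_two herg hqc hper (ind μ 2 B hB)).1).comp
      (tendsto_id.atTop_mul_const' (NeZero.pos d))
    -- Along multiples of `d` the distance to the limit does not depend on `n`, so it is zero and
    -- `1_B` is a function of `φ`.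
    have hconst : ∀ n : ℕ, ‖(markovOp κ μ h 2 ^ (n * d)) (ind μ 2 B hB) -
        cyclicLimit μ hφ.measurable 2 ((n * d : ℕ) : ZMod d) (ind μ 2 B hB)‖ =
        ‖ind μ 2 B hB - cyclicLimit μ hφ.measurable 2 0 (ind μ 2 B hB)‖ := fun n => by
      rw [pow_mul_apply_eq_self hinv2, Nat.cast_mul, ZMod.natCast_self, mul_zero]
    have h0 := tendsto_nhds_unique (hlim.congr hconst) tendsto_const_nhds
    have heq := sub_eq_zero.1 (norm_eq_zero.1 h0.symm)
    have hind : ∀ᵐ x ∂μ, B.indicator (fun _ => (1 : ℂ)) x =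
        (d : ℂ) * ∫ y in φ ⁻¹' {φ x}, ind μ 2 B hB y ∂μ := by
      filter_upwards [coeFn_ind (μ := μ) (p := 2) hB,
        coeFn_cyclicLimit hφ.measurable 2 0 (ind μ 2 B hB)] with x h1 h2
      rw [← h1, ← sub_zero (φ x), ← h2, ← heq]
    refine ⟨{j | (d : ℂ) * ∫ y in φ ⁻¹' {j}, ind μ 2 B hB y ∂μ = 1}, ?_⟩
    filter_upwards [hind] with x hx
    refine propext (Iff.trans ?_ (Eq.congr_left hx))
    change x ∈ B ↔ _
    by_cases hxB : x ∈ B <;> simp [hxB]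
  · rintro ⟨hB, J, hJ⟩
    refine ⟨hB, ?_⟩
    rw [(ind_ae_eq_iff hB (hφ.measurableSet_preimage J)).2 hJ, hφ.markovOp_pow_ind]
    exact ind_congr _ _ (by simp)

lemma finiteMod_invariantSets {h : Kernel.Invariant κ μ} (herg : IsErgodic κ μ h)
    (hqc : IsQuasiCompact (markovOp κ μ h 2)) (hper : IsPeriod (markovOp κ μ h 2) d)
    (hφ : IsCyclicIndex κ μ φ) : FiniteMod μ (invariantSets κ μ h d) := by
  refine ⟨Set.range fun J : Set (ZMod d) => φ ⁻¹' J, Set.finite_range _, fun B hB => ?_⟩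
  obtain ⟨-, J, hJ⟩ := (hφ.mem_invariantSets_iff herg hqc hper).1 hB
  exact ⟨_, ⟨J, rfl⟩, hJ⟩

lemma isAtomOf_preimage_singleton {h : Kernel.Invariant κ μ} (herg : IsErgodic κ μ h)
    (hqc : IsQuasiCompact (markovOp κ μ h 2)) (hper : IsPeriod (markovOp κ μ h 2) d)
    (hφ : IsCyclicIndex κ μ φ) (j : ZMod d) :
    IsAtomOf μ (invariantSets κ μ h d) (φ ⁻¹' {j}) := by
  refine ⟨(hφ.mem_invariantSets_iff herg hqc hper).2 ⟨hφ.measurableSet_preimage _, {j}, .rfl⟩,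
    ?_, fun B hB hBj => ?_⟩
  · have := hφ.measureReal_preimage h j
    refine pos_of_ne_zero fun h0 => ?_
    rw [measureReal_def, h0, ENNReal.toReal_zero, eq_comm, inv_eq_zero, Nat.cast_eq_zero] at this
    exact NeZero.ne d this
  · obtain ⟨-, J, hJ⟩ := (hφ.mem_invariantSets_iff herg hqc hper).1 hB
    by_cases hj : j ∈ J
    · right
      rw [measure_congr ((ae_eq_refl (φ ⁻¹' {j})).diff hJ), ← Set.preimage_sdiff,
        Set.sdiff_eq_empty.2 (Set.singleton_subset_iff.2 hj), Set.preimage_empty, measure_empty]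
    · left
      have hempty : J ∩ {j} = ∅ := by simpa using hj
      rw [← Set.inter_eq_left.2 hBj, measure_congr (hJ.inter (ae_eq_refl (φ ⁻¹' {j}))),
        ← Set.preimage_inter, hempty, Set.preimage_empty, measure_empty]

/-- An invariant set differs from a union of classes by two null sets, which are generators
themselves. Conversely, agreeing almost everywhere with some `φ ⁻¹' J` is stable under complements
and countable unions; the equality thus also shows that the invariant sets form a `σ`-algebra. -/
lemma isGeneratedMod_invariantSets {h : Kernel.Invariant κ μ} (herg : IsErgodic κ μ h)
    (hqc : IsQuasiCompact (markovOp κ μ h 2)) (hper : IsPeriod (markovOp κ μ h 2) d)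
    (hφ : IsCyclicIndex κ μ φ) :
    IsGeneratedMod μ (invariantSets κ μ h d) (Set.range fun j : ZMod d => φ ⁻¹' {j}) := by
  refine Set.ext fun B => ?_
  rw [hφ.mem_invariantSets_iff herg hqc hper]
  set 𝓒 : Set (Set S) := (Set.range fun j : ZMod d => φ ⁻¹' {j}) ∪ {N | MeasurableSet N ∧ μ N = 0}
  constructor
  · rintro ⟨hB, J, hJ⟩
    have hJm : MeasurableSet[MeasurableSpace.generateFrom 𝓒] (φ ⁻¹' J) := by
      rw [← Set.biUnion_preimage_singleton]
      exact MeasurableSet.biUnion J.to_countable fun j _ =>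
        MeasurableSpace.measurableSet_generateFrom (.inl ⟨j, rfl⟩)
    have h1 : MeasurableSet[MeasurableSpace.generateFrom 𝓒] (B \ φ ⁻¹' J) :=
      MeasurableSpace.measurableSet_generateFrom
        (.inr ⟨hB.diff (hφ.measurableSet_preimage J), (ae_le_set.1 hJ.le)⟩)
    have h2 : MeasurableSet[MeasurableSpace.generateFrom 𝓒] (φ ⁻¹' J \ B) :=
      MeasurableSpace.measurableSet_generateFrom
        (.inr ⟨(hφ.measurableSet_preimage J).diff hB, (ae_le_set.1 hJ.symm.le)⟩)
    have hdecomp : B = (φ ⁻¹' J \ (φ ⁻¹' J \ B)) ∪ (B \ φ ⁻¹' J) := by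
      rw [Set.sdiff_sdiff_right_self, Set.inter_comm, Set.inter_union_sdiff]
    rw [hdecomp]
    exact (hJm.diff h2).union h1
  · intro hB
    refine MeasurableSpace.generateFrom_induction 𝓒
      (fun B _ => MeasurableSet B ∧ ∃ J : Set (ZMod d), B =ᵐ[μ] φ ⁻¹' J) ?_ ?_ ?_ ?_ B hB
    · rintro t (⟨j, rfl⟩ | ⟨ht, ht0⟩) -
      · exact ⟨hφ.measurableSet_preimage _, {j}, .rfl⟩
      · exact ⟨ht, ∅, by simpa using ae_eq_empty.2 ht0⟩
    · exact ⟨.empty, ∅, .rfl⟩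
    · rintro t - ⟨ht, J, hJ⟩
      exact ⟨ht.compl, Jᶜ, hJ.compl⟩
    · intro s _ hs
      choose hm J hJ using hs
      exact ⟨.iUnion hm, ⋃ n, J n, by
        rw [Set.preimage_iUnion]
        exact Filter.EventuallyEq.countable_iUnion hJ⟩

/-- Unimodular eigenfunctions are bounded, so they lie in every `L^p` and the period, defined on
`L²`, governs all exponents. -/
lemma hasEigenvalue_iff {h : Kernel.Invariant κ μ} (herg : IsErgodic κ μ h)
    (hper : IsPeriod (markovOp κ μ h 2) d) (hφ : IsCyclicIndex κ μ φ) (p : ℝ≥0∞) [Fact (1 ≤ p)]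
    {z : ℂ} (hz : ‖z‖ = 1) :
    Module.End.HasEigenvalue (markovOp κ μ h p : Lp ℂ p μ →ₗ[ℂ] Lp ℂ p μ) z ↔ z ^ d = 1 := by
  refine ⟨fun hev => ?_, fun hzd => ?_⟩
  · obtain ⟨v, hv⟩ := hev.exists_hasEigenvector
    obtain ⟨c, f, hf, -⟩ :=
      herg.exists_isUnimodularEigenfunction hz hv.2 (Module.End.mem_eigenspace_iff.1 hv.1)
    exact hf.pow_eq_one hper
  · have hf := hφ.isUnimodularEigenfunction hzd
    exact Module.End.hasEigenvalue_of_hasEigenvector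
      ⟨Module.End.mem_eigenspace_iff.2 (hf.markovOp_toLp h p), hf.toLp_ne_zero p⟩

end IsCyclicIndex

lemma IsErgodic.norm_eigenvector_ae_const {h : Kernel.Invariant κ μ} (herg : IsErgodic κ μ h)
    {p : ℝ≥0∞} [hp : Fact (1 ≤ p)] {z : ℂ} (hz : ‖z‖ = 1) {f : Lp ℂ p μ}
    (hf : markovOp κ μ h p f = z • f) : ∃ c : ℝ, ∀ᵐ x ∂μ, ‖f x‖ = c := by
  refine herg.norm_ae_const ((Lp.memLp f).integrable hp.out) hz ?_
  filter_upwards [coeFn_markovOp h f, Lp.coeFn_smul z f] with x h1 h2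
  rw [← h1, hf, h2, Pi.smul_apply, smul_eq_mul]

end InvariantSets

end MarkovCycle

/-! ### The theorem, with the level sets of the cyclic index as atoms -/

theorem theorem4 {S : Type*} [MeasurableSpace S] (μ : Measure S) [IsProbabilityMeasure μ]
    (κ : Kernel S S) [IsMarkovKernel κ] (hinv : Kernel.Invariant κ μ)
    (herg : MarkovCycle.IsErgodic κ μ hinv)
    (hqc : MarkovCycle.IsQuasiCompact (MarkovCycle.markovOp κ μ hinv 2))
    (d : ℕ) (hper : MarkovCycle.IsPeriod (MarkovCycle.markovOp κ μ hinv 2) d) (hd : 1 < d) :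
    -- the cycle of atoms, indexed modulo `d`
    (∃ (A : ZMod d → Set S) (hA : ∀ j, MeasurableSet (A j)),
      -- (i)
      (MarkovCycle.FiniteMod μ (MarkovCycle.invariantSets κ μ hinv d) ∧
        (∀ j, MarkovCycle.IsAtomOf μ (MarkovCycle.invariantSets κ μ hinv d) (A j)) ∧
        (∀ i j, i ≠ j → Disjoint (A i) (A j)) ∧
        (∀ j : ℕ, (MarkovCycle.markovOp κ μ hinv ∞ ^ j) (MarkovCycle.ind μ ∞ (A 0) (hA 0)) =
          MarkovCycle.ind μ ∞ (A j) (hA j)) ∧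
        (∀ j, MarkovCycle.markovOp κ μ hinv ∞ (MarkovCycle.ind μ ∞ (A j) (hA j)) =
          MarkovCycle.ind μ ∞ (A (j + 1)) (hA (j + 1))) ∧
        (∀ j, MarkovCycle.dualOp κ μ hinv ∞ (MarkovCycle.ind μ ∞ (A (j + 1)) (hA (j + 1))) =
          MarkovCycle.ind μ ∞ (A j) (hA j)) ∧
        MarkovCycle.IsGeneratedMod μ (MarkovCycle.invariantSets κ μ hinv d) (Set.range A)) ∧
      -- (ii)
      (∀ (p : ℝ≥0∞) [Fact (1 ≤ p)], p ≠ ∞ → ∀ (f : Lp ℂ p μ) (j : ℕ), j < d →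
        Tendsto (fun n : ℕ => ‖(MarkovCycle.markovOp κ μ hinv p ^ (n * d + j)) f -
          (d : ℂ) • ∑ l ∈ Finset.range d,
            (∫ x in A l, f x ∂μ) • MarkovCycle.ind μ p (A (l + j)) (hA (l + j))‖) atTop (𝓝 0) ∧
        Tendsto (fun n : ℕ => ‖(MarkovCycle.dualOp κ μ hinv p ^ (n * d + j)) f -
          (d : ℂ) • ∑ l ∈ Finset.range d,
            (∫ x in A l, f x ∂μ) • MarkovCycle.ind μ p (A (l - j)) (hA (l - j))‖) atTop (𝓝 0))) ∧
    -- (iii)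
    (∀ (p : ℝ≥0∞) [Fact (1 ≤ p)], p ≠ ∞ → ∀ z : ℂ, ‖z‖ = 1 →
      (Module.End.HasEigenvalue (MarkovCycle.markovOp κ μ hinv p : Lp ℂ p μ →ₗ[ℂ] Lp ℂ p μ) z ↔
        z ^ d = 1) ∧
      ∀ f : Lp ℂ p μ, MarkovCycle.markovOp κ μ hinv p f = z • f →
        ∃ c : ℝ, ∀ᵐ x ∂μ, ‖f x‖ = c) := by
  have : NeZero d := ⟨by omega⟩
  obtain ⟨φ, hφ⟩ := herg.exists_isCyclicIndex hqc hper
  refine ⟨⟨fun j => φ ⁻¹' {j}, fun j => hφ.measurableSet_preimage _,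
    ⟨hφ.finiteMod_invariantSets herg hqc hper, hφ.isAtomOf_preimage_singleton herg hqc hper,
      fun i j hij => Disjoint.preimage _ (Set.disjoint_singleton.2 hij), fun j => ?_, fun j => ?_,
      fun j => ?_, hφ.isGeneratedMod_invariantSets herg hqc hper⟩, ?_⟩,
    fun p _ _ z hz => ⟨hφ.hasEigenvalue_iff herg hper p hz,
      fun f hf => herg.norm_eigenvector_ae_const hz hf⟩⟩
  · simpa only [zero_add] using hφ.markovOp_pow_ind_singleton hinv ∞ 0 j
  · simpa only [pow_one, Nat.cast_one] using hφ.markovOp_pow_ind_singleton hinv ∞ j 1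
  · simpa only [pow_one, Nat.cast_one, add_sub_cancel_right] using
      hφ.dualOp_pow_ind_singleton hinv ∞ (j + 1) 1
  · intro p _ hp f j _
    obtain ⟨h1, h2⟩ := hφ.tendsto_pow_sub_cyclicLimit herg hqc hper p hp f
    -- Along `n * d + j` the shift in the limit is constantly `j` modulo `d`, so the moving limit
    -- becomes a fixed function.
    have hsub : Tendsto (fun n : ℕ => n * d + j) atTop atTop :=
      tendsto_atTop_mono (fun n => (Nat.le_mul_of_pos_right n (NeZero.pos d)).trans
        (Nat.le_add_right _ _)) tendsto_id
    have hcast : ∀ n : ℕ, ((n * d + j : ℕ) : ZMod d) = j := fun n => by simp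
    refine ⟨(h1.comp hsub).congr fun n => ?_, (h2.comp hsub).congr fun n => ?_⟩
    · rw [Function.comp_apply, hcast, MarkovCycle.cyclicLimit_apply,
        ← MarkovCycle.sum_range_natCast_zmod]
    · rw [Function.comp_apply, hcast, MarkovCycle.cyclicLimit_apply,
        ← MarkovCycle.sum_range_natCast_zmod]
      simp only [sub_eq_add_neg]
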